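/- Setting. For each $n\ge 1$ let $\mathbf y=X\beta^0+\epsilon$, where $\beta^0=\beta^0_{(n)}\in\mathbb R^{p}$, $p=p_n$, is deterministic, $X$ is a deterministic or random $n\times p$ matrix independent of $\epsilon$, and $\epsilon\sim N(0,\sigma_0^2I_n)$ with fixed $\sigma_0>0$; all the random objects live on one probability space. A model is a subset $\gamma\subseteq\{1,\dots,p\}$ (equivalently its 0-1 state vector), $|\gamma|$ is its size, $X_\gamma$ is the submatrix of the columns of $X$ indexed by $\gamma$, and $P_\gamma=X_\gamma(X_\gamma^TX_\gamma)^{-1}X_\gamma^T$, $P_\emptyset=0$. The true model is $\gamma^0=\{j:\beta^0_j\ne0\}$; put $k_n=\|\beta^0\|_2^2$, $S_1=\{\gamma:\gamma^0\subsetneq\gamma\}$, $S_2=\{\gamma:\gamma^0\not\subseteq\gamma\}$. With $\lambda_-,\lambda_+$ the minimal and maximal eigenvalue, let $$\varphi_{\min}(n)=\min_{\gamma\in S_2}\lambda_-\Big(\tfrac1nX_{\gamma^0\setminus\gamma}^T(I_n-P_\gamma)X_{\gamma^0\setminus\gamma}\Big),\qquad \varphi_{\max}(n)=\max_{\gamma\in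 S_2}\lambda_+\Big(\tfrac1nX_{\gamma^0\setminus\gamma}^TX_{\gamma^0\setminus\gamma}\Big).$$ Let $p(\cdot)$ be a prior probability distribution on the $2^p$ models (for each $n$), let $\nu>0$ be fixed, and for $c=(c_1,\dots,c_p)$ with positive entries let $\Sigma_\gamma=\mathrm{diag}(c_j)_{j\in\gamma}$, $U_\gamma=\Sigma_\gamma^{-1}+X_\gamma^TX_\gamma$, $W_\gamma=\Sigma_\gamma^{1/2}U_\gamma\Sigma_\gamma^{1/2}$. The posterior distribution of $\gamma$ given $Z=(\mathbf y,X)$ is the probability distribution on the models with $$p(\gamma|Z)\propto(2\pi)^{-n/2}\det(W_\gamma)^{-1/2}\,p(\gamma)\left\{\frac{2}{1+\mathbf y^T(I_n-X_\gamma U_\gamma^{-1}X_\gamma^T)\mathbf y}\right\}^{(n+\nu)/2},$$ where for $\gamma=\emptyset$ the determinant is $1$ and the denominator is $1+\mathbf y^T\mathbf y$. Theorem. Suppose that: (i) $\gamma^0\neq\emptyset$ for every $n$; (ii) there is a constant $C_0>0$ such that $p(\gamma^0)>0$ and $\max_\gamma p(\gamma)/p(\gamma^0)\le C_0$ for every $n$;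 (iii) there are constants $C_1,C_2>0$ such that, with probability one, $\liminf_n\varphi_{\min}(n)\ge C_1$ and $\limsup_n\varphi_{\max}(n)\le C_2$; (iv) there are constants $C_3>0$ and $\delta\ge0$ such that for every $n$, with probability one, $$\lambda_-\Big(\tfrac1nX_{\gamma\setminus\gamma^0}^T(I_n-P_{\gamma^0})X_{\gamma\setminus\gamma^0}\Big)\ge C_3n^{-\delta}\quad\text{for all }\gamma\in S_1;$$ (v) $\min_{j\in\gamma^0}|\beta^0_j|\ge\psi_n$ for every $n$, where $\inf_n\psi_n>0$; (vi) $p\log n=o(n)$; (vii) there is a constant $\delta_0>3+\delta$ such that $k_n=O(n^{\delta_0})$, and $0<\underline\phi_n\le\bar\phi_n$ are sequences with $\bar\phi_n=O(n^{\delta_0})$ and $n^{\delta_0}=O(\underline\phi_n)$. Then $$\inf_{c_1,\dots,c_p\in[\underline\phi_n,\bar\phi_n]}p(\gamma^0|Z)\longrightarrow1\quad\text{in probability as }n\to\infty.$$ -/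

import Mathlib

open MeasureTheory ProbabilityTheory Filter Asymptotics Matrix
open scoped Topology NNReal

namespace BayesSel

noncomputable section

/-- The model (state vector) of a coefficient vector `β`: the set of `j` with `β j ≠ 0`. State
vectors `γ ∈ {0,1}^p` are identified with subsets of `Fin p`. -/
def stateOf {p : ℕ} (β : Fin p → ℝ) : Finset (Fin p) :=
  Finset.univ.filter fun j => β j ≠ 0

/-- Models that strictly contain the true model. -/
def S₁ {p : ℕ} (γ₀ : Finset (Fin p)) : Set (Finset (Fin p)) :=
  {γ | γ₀ ⊆ γ ∧ γ ≠ γ₀}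

/-- Models in which the true model is not nested. -/
def S₂ {p : ℕ} (γ₀ : Finset (Fin p)) : Set (Finset (Fin p)) :=
  {γ | ¬ γ₀ ⊆ γ}

/-- The submatrix `X_γ` of the columns of `X` indexed by `γ`. -/
def cols {n p : ℕ} (X : Matrix (Fin n) (Fin p) ℝ) (γ : Finset (Fin p)) : Matrix (Fin n) γ ℝ :=
  X.submatrix id (fun j : γ => (j : Fin p))

/-- The projection matrix `P_γ = X_γ (X_γᵀ X_γ)⁻¹ X_γᵀ` (which is `0` for the empty model). -/
def proj {n p : ℕ} (X : Matrix (Fin n) (Fin p) ℝ) (γ : Finset (Fin p)) :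
    Matrix (Fin n) (Fin n) ℝ :=
  cols X γ * ((cols X γ)ᵀ * cols X γ)⁻¹ * (cols X γ)ᵀ

/-- The minimal eigenvalue (used for symmetric matrices of positive size only). -/
def eigMin {m : Type*} [Fintype m] [DecidableEq m] (A : Matrix m m ℝ) : ℝ :=
  sInf (spectrum ℝ A)

/-- The maximal eigenvalue (used for symmetric matrices of positive size only). -/
def eigMax {m : Type*} [Fintype m] [DecidableEq m] (A : Matrix m m ℝ) : ℝ :=
  sSup (spectrum ℝ A)

/-- The matrix `n⁻¹ X_ηᵀ (Iₙ - P_γ) X_η`. -/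
def residGram {n p : ℕ} (X : Matrix (Fin n) (Fin p) ℝ) (η γ : Finset (Fin p)) :
    Matrix η η ℝ :=
  (1 / (n : ℝ)) • ((cols X η)ᵀ * (1 - proj X γ) * cols X η)

/-- `φ_min(n)`, the minimum over `γ ∈ S₂` of
`λ₋(n⁻¹ X_{γ₀ \ γ}ᵀ (Iₙ - P_γ) X_{γ₀ \ γ})`. -/
def phiMin {n p : ℕ} (γ₀ : Finset (Fin p)) (X : Matrix (Fin n) (Fin p) ℝ) : ℝ :=
  ⨅ γ : S₂ γ₀, eigMin (residGram X (γ₀ \ (γ : Finset (Fin p))) γ)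

/-- `φ_max(n)`, the maximum over `γ ∈ S₂` of `λ₊(n⁻¹ X_{γ₀ \ γ}ᵀ X_{γ₀ \ γ})`. -/
def phiMax {n p : ℕ} (γ₀ : Finset (Fin p)) (X : Matrix (Fin n) (Fin p) ℝ) : ℝ :=
  ⨆ γ : S₂ γ₀, eigMax ((1 / (n : ℝ)) •
    ((cols X (γ₀ \ (γ : Finset (Fin p))))ᵀ * cols X (γ₀ \ (γ : Finset (Fin p)))))

/-- `Σ_γ = diag (c_j : j ∈ γ)`. -/
def sigmaMat {p : ℕ} (c : Fin p → ℝ) (γ : Finset (Fin p)) : Matrix γ γ ℝ :=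
  Matrix.diagonal fun j : γ => c j

/-- `Σ_γ^{1/2}`. -/
def sigmaSqrt {p : ℕ} (c : Fin p → ℝ) (γ : Finset (Fin p)) : Matrix γ γ ℝ :=
  Matrix.diagonal fun j : γ => Real.sqrt (c j)

/-- `U_γ = Σ_γ⁻¹ + X_γᵀ X_γ`. -/
def uMat {n p : ℕ} (c : Fin p → ℝ) (X : Matrix (Fin n) (Fin p) ℝ) (γ : Finset (Fin p)) :
    Matrix γ γ ℝ :=
  (sigmaMat c γ)⁻¹ + (cols X γ)ᵀ * cols X γ

/-- `W_γ = Σ_γ^{1/2} U_γ Σ_γ^{1/2}`. -/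
def wMat {n p : ℕ} (c : Fin p → ℝ) (X : Matrix (Fin n) (Fin p) ℝ) (γ : Finset (Fin p)) :
    Matrix γ γ ℝ :=
  sigmaSqrt c γ * uMat c X γ * sigmaSqrt c γ

/-- The unnormalized posterior weight of the model `γ` given the data `(y, X)`,
`(2π)^{-n/2} det(W_γ)^{-1/2} p(γ) {2 / (1 + yᵀ (Iₙ - X_γ U_γ⁻¹ X_γᵀ) y)}^{(n+ν)/2}`. For the empty
model the determinant is `1` and the quadratic form is `yᵀ y`. -/
def postWeight {n p : ℕ} (ν : ℝ) (prior : PMF (Finset (Fin p))) (c : Fin p → ℝ)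
    (X : Matrix (Fin n) (Fin p) ℝ) (y : Fin n → ℝ) (γ : Finset (Fin p)) : ℝ :=
  (2 * Real.pi) ^ (-(n : ℝ) / 2) * (wMat c X γ).det ^ (-(1 / 2) : ℝ) * (prior γ).toReal *
    (2 / (1 + y ⬝ᵥ ((1 - cols X γ * (uMat c X γ)⁻¹ * (cols X γ)ᵀ) *ᵥ y))) ^ (((n : ℝ) + ν) / 2)

/-- The posterior probability `p(γ | Z)` of the model `γ` given the data `Z = (y, X)`. -/
def posterior {n p : ℕ} (ν : ℝ) (prior : PMF (Finset (Fin p))) (c : Fin p → ℝ)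
    (X : Matrix (Fin n) (Fin p) ℝ) (y : Fin n → ℝ) (γ : Finset (Fin p)) : ℝ :=
  postWeight ν prior c X y γ / ∑ γ' : Finset (Fin p), postWeight ν prior c X y γ'

end

end BayesSel

/-! Write `R γ` for `ridgeRss`, `e` for the noise and `v = σ₀²`. The odds of `γ` against the true
model `γ₀` are a prior ratio, bounded by `C₀`, times `(det W_γ₀ / det W_γ)^(1/2)` times `((1 + R γ₀)
/ (1 + R γ))^((n+ν)/2)`. Since the posterior of `γ₀` is at least one minus the sum of these odds, it
suffices to make that sum small, uniformly in `c`. As `R γ` is the minimum of a ridge criterion, it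
dominates the least-squares residual, and `R γ₀` exceeds its own least-squares residual by at most a
constant `K`, because `k_n / φlo` is bounded.

Overfitting. If `γ` adds `k` columns to `γ₀`, the determinant ratio contributes at most a constant
to the power `k` times `n^(-(2+κ/2)k)`, where `κ = δ₀ - 3 - δ > 0` (`det_wMat_mul_le`). The
improvement in fit is a chi-square variable with `k` degrees of freedom. A Chernoff and union bound
keeps it below `2v(1+a)k log n` for all such `γ` at once, and it is divided by a residual of order
`vn`, so the last factor is at most a constant times `n^((1+κ/4)k)`. The odds are thus at most a
constant times `x^k` with `x = O(n^(-(1+κ/4)))`, and summing over all supersets gives `(1+x)^p - 1 →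
0`, since `p ≤ n` eventually.

Underfitting. If `γ` misses a true coefficient, `R γ - R γ₀` is at least of order `n`
(`le_ridgeRss_of_not_subset`), while `R γ₀ = O(n)`. The last factor is then exponentially small in
`n`, and it beats both the number `2^p` of models and `det W_γ₀`, which are `exp(O(p log n)) =
exp(o(n))`.

`one_sub_le_posterior` joins the two cases on a fixed outcome. The probabilistic part shows that its
hypotheses fail with vanishing probability. -/

namespace BayesSel

set_option linter.unusedSectionVars false

/-! ### Quadratic forms, eigenvalues and orthogonal projections. -/

section QuadraticForms

variable {m n : Type*} [Fintype m] [Fintype n] [DecidableEq m] [DecidableEq n]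

theorem dotProduct_gram_mulVec (A : Matrix n m ℝ) (v : m → ℝ) :
    v ⬝ᵥ ((Aᵀ * A) *ᵥ v) = (A *ᵥ v) ⬝ᵥ (A *ᵥ v) := by
  rw [← mulVec_mulVec, dotProduct_mulVec, vecMul_transpose]

theorem isHermitian_of_transpose_eq {A : Matrix m m ℝ} (h : Aᵀ = A) : A.IsHermitian := by
  rw [IsHermitian, conjTranspose_eq_transpose_of_trivial, h]

theorem dotProduct_self_nonneg' (v : m → ℝ) : 0 ≤ v ⬝ᵥ v :=
  Finset.sum_nonneg fun i _ => mul_self_nonneg (v i)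

theorem posDef_of_le_form {A : Matrix m m ℝ} (hA : Aᵀ = A) {c : ℝ} (hc : 0 < c)
    (h : ∀ v, c * (v ⬝ᵥ v) ≤ v ⬝ᵥ (A *ᵥ v)) : A.PosDef := by
  refine PosDef.of_dotProduct_mulVec_pos (isHermitian_of_transpose_eq hA) fun x hx => ?_
  have h0 : 0 < x ⬝ᵥ x :=
    lt_of_le_of_ne (dotProduct_self_nonneg' x) fun h => hx (dotProduct_self_eq_zero.1 h.symm)
  exact (mul_pos hc h0).trans_le (by simpa using h x)

theorem IsHermitian.form_eigenvector {A : Matrix m m ℝ} (hA : A.IsHermitian) (i : m) :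
    ∃ v : m → ℝ, v ⬝ᵥ v = 1 ∧ v ⬝ᵥ (A *ᵥ v) = hA.eigenvalues i := by
  refine ⟨(hA.eigenvectorBasis i).ofLp, ?_, ?_⟩
  · have h := hA.eigenvectorBasis.orthonormal.1 i
    have h2 : inner ℝ (hA.eigenvectorBasis i) (hA.eigenvectorBasis i) = (1 : ℝ) := by
      rw [real_inner_self_eq_norm_sq, h]; norm_num
    rw [EuclideanSpace.inner_eq_star_dotProduct] at h2
    simpa using h2
  · rw [hA.eigenvalues_eq]; simp

/-- Testing the form on unit eigenvectors puts every eigenvalue above `c`, and the determinant is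
their product. -/
theorem pow_card_le_det {A : Matrix m m ℝ} (hA : Aᵀ = A) {c : ℝ} (hc : 0 ≤ c)
    (h : ∀ v, c * (v ⬝ᵥ v) ≤ v ⬝ᵥ (A *ᵥ v)) : c ^ Fintype.card m ≤ A.det := by
  have hH := isHermitian_of_transpose_eq hA
  rw [hH.det_eq_prod_eigenvalues, ← Finset.card_univ, ← Finset.prod_const]
  refine Finset.prod_le_prod (fun _ _ => hc) fun i _ => ?_
  obtain ⟨v, h1, h2⟩ := IsHermitian.form_eigenvector hH i
  simpa [h1, h2] using h v

theorem det_le_pow_card {A : Matrix m m ℝ} (hA : A.PosSemidef) {c : ℝ}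
    (h : ∀ v, v ⬝ᵥ (A *ᵥ v) ≤ c * (v ⬝ᵥ v)) : A.det ≤ c ^ Fintype.card m := by
  rw [hA.1.det_eq_prod_eigenvalues, ← Finset.card_univ, ← Finset.prod_const]
  refine Finset.prod_le_prod (fun i _ => by simpa using hA.eigenvalues_nonneg i) fun i _ => ?_
  obtain ⟨v, h1, h2⟩ := IsHermitian.form_eigenvector hA.1 i
  simpa [h1, h2] using h v

theorem IsHermitian.form_eq {A : Matrix m m ℝ} (hA : A.IsHermitian) (v : m → ℝ) :
    v ⬝ᵥ (A *ᵥ v) = ∑ i, hA.eigenvalues i *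
      (((hA.eigenvectorUnitary : Matrix m m ℝ)ᵀ *ᵥ v) i) ^ 2 := by
  set U : Matrix m m ℝ := (hA.eigenvectorUnitary : Matrix m m ℝ) with hU
  have h : A = U * diagonal hA.eigenvalues * Uᵀ := by
    conv_lhs => rw [hA.spectral_theorem]
    rw [Unitary.conjStarAlgAut_apply, star_eq_conjTranspose,
      conjTranspose_eq_transpose_of_trivial]
    rfl
  conv_lhs => rw [h]
  rw [← mulVec_mulVec, ← mulVec_mulVec, dotProduct_mulVec, ← mulVec_transpose, dotProduct]
  refine Finset.sum_congr rfl fun i _ => ?_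
  rw [mulVec_diagonal]; ring

theorem eigenvectorUnitary_mul_transpose {A : Matrix m m ℝ} (hA : A.IsHermitian) :
    (hA.eigenvectorUnitary : Matrix m m ℝ) * (hA.eigenvectorUnitary : Matrix m m ℝ)ᵀ = 1 := by
  have := Unitary.coe_mul_star_self hA.eigenvectorUnitary
  rwa [Unitary.coe_star, star_eq_conjTranspose, conjTranspose_eq_transpose_of_trivial] at this

theorem eigenvectorUnitary_transpose_mul {A : Matrix m m ℝ} (hA : A.IsHermitian) :
    (hA.eigenvectorUnitary : Matrix m m ℝ)ᵀ * (hA.eigenvectorUnitary : Matrix m m ℝ) = 1 := by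
  have := Unitary.coe_star_mul_self hA.eigenvectorUnitary
  rwa [star_eq_conjTranspose, conjTranspose_eq_transpose_of_trivial] at this

theorem sum_sq_eigenvectorUnitary {A : Matrix m m ℝ} (hA : A.IsHermitian) (v : m → ℝ) :
    ∑ i, (((hA.eigenvectorUnitary : Matrix m m ℝ)ᵀ *ᵥ v) i) ^ 2 = v ⬝ᵥ v := by
  set U : Matrix m m ℝ := (hA.eigenvectorUnitary : Matrix m m ℝ) with hU
  have : (Uᵀ *ᵥ v) ⬝ᵥ (Uᵀ *ᵥ v) = v ⬝ᵥ v := by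
    rw [← dotProduct_gram_mulVec, transpose_transpose, eigenvectorUnitary_mul_transpose,
      one_mulVec]
  rw [← this]
  exact Finset.sum_congr rfl fun i _ => sq _

/-- Expansion in an orthonormal eigenbasis. All later estimates use forms, which behave better than
`eigMin` under scaling and measurability. -/
theorem form_ge_of_le_eigMin {A : Matrix m m ℝ} (hA : Aᵀ = A) {c : ℝ} (hc : c ≤ eigMin A)
    (v : m → ℝ) : c * (v ⬝ᵥ v) ≤ v ⬝ᵥ (A *ᵥ v) := by
  have hH := isHermitian_of_transpose_eq hA
  rw [IsHermitian.form_eq hH, ← sum_sq_eigenvectorUnitary hH, Finset.mul_sum]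
  refine Finset.sum_le_sum fun i _ => mul_le_mul_of_nonneg_right ?_ (sq_nonneg _)
  exact hc.trans (csInf_le (finite_real_spectrum (A := A)).bddBelow
    (hH.eigenvalues_mem_spectrum_real i))

theorem form_le_of_eigMax_le {A : Matrix m m ℝ} (hA : Aᵀ = A) {c : ℝ} (hc : eigMax A ≤ c)
    (v : m → ℝ) : v ⬝ᵥ (A *ᵥ v) ≤ c * (v ⬝ᵥ v) := by
  have hH := isHermitian_of_transpose_eq hA
  rw [IsHermitian.form_eq hH, ← sum_sq_eigenvectorUnitary hH, Finset.mul_sum]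
  refine Finset.sum_le_sum fun i _ => mul_le_mul_of_nonneg_right ?_ (sq_nonneg _)
  exact (le_csSup (finite_real_spectrum (A := A)).bddAbove
    (hH.eigenvalues_mem_spectrum_real i)).trans hc

/-- `|D v|² = v ⬝ᵥ D v` for an orthogonal projection `D`. -/
theorem dotProduct_of_idem {D : Matrix m m ℝ} (hs : Dᵀ = D) (hi : D * D = D) (v : m → ℝ) :
    (D *ᵥ v) ⬝ᵥ (D *ᵥ v) = v ⬝ᵥ (D *ᵥ v) := by
  rw [← dotProduct_gram_mulVec, hs, hi]

theorem form_idem_nonneg {D : Matrix m m ℝ} (hs : Dᵀ = D) (hi : D * D = D) (v : m → ℝ) :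
    0 ≤ v ⬝ᵥ (D *ᵥ v) := by
  rw [← dotProduct_of_idem hs hi]; exact dotProduct_self_nonneg' _

theorem one_sub_idem {D : Matrix m m ℝ} (hi : D * D = D) : (1 - D) * (1 - D) = 1 - D := by
  simp [sub_mul, mul_sub, hi]

theorem one_sub_symm {D : Matrix m m ℝ} (hs : Dᵀ = D) : (1 - D)ᵀ = 1 - D := by
  simp [hs]

theorem form_idem_le {D : Matrix m m ℝ} (hs : Dᵀ = D) (hi : D * D = D) (v : m → ℝ) :
    v ⬝ᵥ (D *ᵥ v) ≤ v ⬝ᵥ v := by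
  have := form_idem_nonneg (one_sub_symm hs) (one_sub_idem hi) v
  rw [sub_mulVec, one_mulVec, dotProduct_sub] at this
  linarith

end QuadraticForms

/-! ### The ridge criterion and its minimum. -/

section Ridge

variable {m n : Type*} [Fintype m] [Fintype n] [DecidableEq m] [DecidableEq n]

/-- The ridge matrix `S + XᵀX` is positive definite when the penalty `S` is. -/
theorem ridge_posDef {S : Matrix m m ℝ} (hS : S.PosDef) (X : Matrix n m ℝ) :
    (S + Xᵀ * X).PosDef := by
  refine hS.add_posSemidef ?_
  simpa [conjTranspose_eq_transpose_of_trivial] using posSemidef_conjTranspose_mul_self X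

theorem posDef_transpose_eq {S : Matrix m m ℝ} (hS : S.PosDef) : Sᵀ = S := by
  simpa [IsHermitian, conjTranspose_eq_transpose_of_trivial] using hS.1

/-- Completing the square in the ridge criterion. -/
theorem ridge_identity {S : Matrix m m ℝ} (hS : S.PosDef) (X : Matrix n m ℝ) (y : n → ℝ)
    (b : m → ℝ) :
    (y - X *ᵥ b) ⬝ᵥ (y - X *ᵥ b) + b ⬝ᵥ (S *ᵥ b) =
      y ⬝ᵥ ((1 - X * (S + Xᵀ * X)⁻¹ * Xᵀ) *ᵥ y) +
      (b - (S + Xᵀ * X)⁻¹ *ᵥ (Xᵀ *ᵥ y)) ⬝ᵥ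
        ((S + Xᵀ * X) *ᵥ (b - (S + Xᵀ * X)⁻¹ *ᵥ (Xᵀ *ᵥ y))) := by
  have hU := ridge_posDef hS X
  set U := S + Xᵀ * X with hUdef
  have hunit : IsUnit U.det := (isUnit_iff_isUnit_det U).1 hU.isUnit
  have hUt : Uᵀ = U := posDef_transpose_eq hU
  set z := Xᵀ *ᵥ y with hz
  have h1 : U *ᵥ (U⁻¹ *ᵥ z) = z := by rw [mulVec_mulVec, mul_nonsing_inv _ hunit, one_mulVec]
  have h2 : (U⁻¹ *ᵥ z) ⬝ᵥ (U *ᵥ b) = z ⬝ᵥ b := by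
    rw [dotProduct_mulVec, ← mulVec_transpose, hUt, h1]
  have h3 : y ⬝ᵥ (X *ᵥ b) = z ⬝ᵥ b := by rw [dotProduct_mulVec, hz, mulVec_transpose]
  have h4 : b ⬝ᵥ (U *ᵥ b) = b ⬝ᵥ (S *ᵥ b) + (X *ᵥ b) ⬝ᵥ (X *ᵥ b) := by
    rw [hUdef, add_mulVec, dotProduct_add, dotProduct_gram_mulVec]
  have h5 : y ⬝ᵥ ((1 - X * U⁻¹ * Xᵀ) *ᵥ y) = y ⬝ᵥ y - z ⬝ᵥ (U⁻¹ *ᵥ z) := by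
    rw [sub_mulVec, one_mulVec, dotProduct_sub, ← mulVec_mulVec, ← mulVec_mulVec, ← hz,
      dotProduct_mulVec y X, ← mulVec_transpose, ← hz]
  rw [h5, mulVec_sub, h1]
  simp only [sub_dotProduct, dotProduct_sub]
  rw [h2, h4, h3, dotProduct_comm (X *ᵥ b) y, h3, dotProduct_comm b z,
    dotProduct_comm (U⁻¹ *ᵥ z) z]
  ring

theorem ridge_le {S : Matrix m m ℝ} (hS : S.PosDef) (X : Matrix n m ℝ) (y : n → ℝ)
    (b : m → ℝ) :
    y ⬝ᵥ ((1 - X * (S + Xᵀ * X)⁻¹ * Xᵀ) *ᵥ y) ≤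
      (y - X *ᵥ b) ⬝ᵥ (y - X *ᵥ b) + b ⬝ᵥ (S *ᵥ b) := by
  rw [ridge_identity hS]
  have := (ridge_posDef hS X).posSemidef.dotProduct_mulVec_nonneg
    (b - (S + Xᵀ * X)⁻¹ *ᵥ (Xᵀ *ᵥ y))
  simp only [star_trivial] at this
  linarith

/-- The ridge criterion dominates the residual sum of squares for every orthogonal projection
fixing the columns of the design. -/
theorem le_ridge {S : Matrix m m ℝ} (hS : S.PosDef) (X : Matrix n m ℝ) (y : n → ℝ)
    {P : Matrix n n ℝ} (hs : Pᵀ = P) (hi : P * P = P) (hP : P * X = X) :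
    y ⬝ᵥ ((1 - P) *ᵥ y) ≤ y ⬝ᵥ ((1 - X * (S + Xᵀ * X)⁻¹ * Xᵀ) *ᵥ y) := by
  -- At the minimizer the completed square vanishes, leaving a squared residual plus a penalty.
  -- Dropping the penalty and applying `1 - P` to the residual can only decrease it.
  have h := ridge_identity hS X y ((S + Xᵀ * X)⁻¹ *ᵥ (Xᵀ *ᵥ y))
  set b := (S + Xᵀ * X)⁻¹ *ᵥ (Xᵀ *ᵥ y) with hb
  rw [sub_self, zero_dotProduct, add_zero] at h
  rw [← h]
  have h1 := hS.posSemidef.dotProduct_mulVec_nonneg b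
  simp only [star_trivial] at h1
  have h2 : (1 - P) *ᵥ (y - X *ᵥ b) = (1 - P) *ᵥ y := by
    rw [mulVec_sub, mulVec_mulVec, Matrix.sub_mul, Matrix.one_mul, hP, sub_self, zero_mulVec, sub_zero]
  have h3 := form_idem_le (one_sub_symm hs) (one_sub_idem hi) (y - X *ᵥ b)
  rw [← dotProduct_of_idem (one_sub_symm hs) (one_sub_idem hi), h2,
    dotProduct_of_idem (one_sub_symm hs) (one_sub_idem hi)] at h3
  linarith

end Ridge

/-! ### Column submatrices and nested projections. -/

section Design

variable {n p : ℕ}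

theorem cols_mulVec_restrict (X : Matrix (Fin n) (Fin p) ℝ) (γ : Finset (Fin p))
    (b : Fin p → ℝ) :
    cols X γ *ᵥ (fun j : γ => b j) = X *ᵥ (fun j => if j ∈ γ then b j else 0) := by
  funext i
  simp only [mulVec, dotProduct, cols, submatrix_apply, id, mul_ite, mul_zero]
  rw [← Finset.sum_filter, Finset.filter_mem_eq_inter, Finset.univ_inter]
  exact Finset.sum_coe_sort γ fun j => X i j * b j

theorem exists_extension (γ : Finset (Fin p)) (v : γ → ℝ) :
    ∃ b : Fin p → ℝ, (fun j : γ => b j) = v ∧ ∀ j ∉ γ, b j = 0 :=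
  ⟨fun j => if h : j ∈ γ then v ⟨j, h⟩ else 0, by funext j; simp, fun j hj => by simp [hj]⟩

theorem cols_mulVec_of_support (X : Matrix (Fin n) (Fin p) ℝ) {γ : Finset (Fin p)}
    {b : Fin p → ℝ} (hb : ∀ j ∉ γ, b j = 0) :
    cols X γ *ᵥ (fun j : γ => b j) = X *ᵥ b := by
  rw [cols_mulVec_restrict]
  congr 1
  funext j
  split_ifs with h
  · rfl
  · exact (hb j h).symm

theorem gram_transpose (X : Matrix (Fin n) (Fin p) ℝ) (γ : Finset (Fin p)) :
    ((cols X γ)ᵀ * cols X γ)ᵀ = (cols X γ)ᵀ * cols X γ := by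
  rw [transpose_mul, transpose_transpose]

theorem proj_transpose (X : Matrix (Fin n) (Fin p) ℝ) (γ : Finset (Fin p)) :
    (proj X γ)ᵀ = proj X γ := by
  simp only [proj, transpose_mul, transpose_transpose, transpose_nonsing_inv, Matrix.mul_assoc]

theorem residGram_transpose (X : Matrix (Fin n) (Fin p) ℝ) (η γ : Finset (Fin p)) :
    (residGram X η γ)ᵀ = residGram X η γ := by
  simp only [residGram, transpose_smul, transpose_mul, transpose_sub, transpose_one,
    proj_transpose, transpose_transpose, Matrix.mul_assoc]

theorem proj_mul_cols {X : Matrix (Fin n) (Fin p) ℝ} {γ : Finset (Fin p)}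
    (h : IsUnit ((cols X γ)ᵀ * cols X γ).det) : proj X γ * cols X γ = cols X γ := by
  rw [proj, Matrix.mul_assoc, Matrix.mul_assoc, nonsing_inv_mul _ h, Matrix.mul_one]

theorem proj_mul_self (X : Matrix (Fin n) (Fin p) ℝ) (γ : Finset (Fin p)) :
    proj X γ * proj X γ = proj X γ := by
  by_cases h : IsUnit ((cols X γ)ᵀ * cols X γ).det
  · conv_lhs => rw [show proj X γ * proj X γ = proj X γ * cols X γ *
      (((cols X γ)ᵀ * cols X γ)⁻¹ * (cols X γ)ᵀ) by simp only [proj, Matrix.mul_assoc]]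
    rw [proj_mul_cols h, proj, Matrix.mul_assoc]
  -- A singular Gram matrix has inverse `0` by convention, so `proj` is `0` and still idempotent.
  · simp [proj, nonsing_inv_apply_not_isUnit _ h]

theorem trace_proj {X : Matrix (Fin n) (Fin p) ℝ} {γ : Finset (Fin p)}
    (h : IsUnit ((cols X γ)ᵀ * cols X γ).det) : (proj X γ).trace = γ.card := by
  rw [proj, trace_mul_cycle, mul_nonsing_inv _ h]
  simp

/-- The selection matrix that picks the columns in `γ` out of those in `γ'`. -/
theorem cols_eq_cols_mul (X : Matrix (Fin n) (Fin p) ℝ) {γ γ' : Finset (Fin p)} (h : γ ⊆ γ') :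
    ∃ J : Matrix γ' γ ℝ, cols X γ = cols X γ' * J := by
  refine ⟨Matrix.of fun i j => if (i : Fin p) = j then 1 else 0, ?_⟩
  ext i j
  simp only [cols, submatrix_apply, id, mul_apply, of_apply, mul_ite, mul_one, mul_zero]
  rw [Finset.sum_eq_single (⟨j, h j.2⟩ : γ')]
  · simp
  · intro b _ hb
    rw [if_neg]
    intro h'
    exact hb (Subtype.ext h')
  · simp

theorem proj_mul_cols_of_subset {X : Matrix (Fin n) (Fin p) ℝ} {γ γ' : Finset (Fin p)}
    (hs : γ ⊆ γ') (h : IsUnit ((cols X γ')ᵀ * cols X γ').det) :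
    proj X γ' * cols X γ = cols X γ := by
  obtain ⟨J, hJ⟩ := cols_eq_cols_mul X hs
  rw [hJ, ← Matrix.mul_assoc, proj_mul_cols h]

theorem proj_mul_proj_of_subset {X : Matrix (Fin n) (Fin p) ℝ} {γ γ' : Finset (Fin p)}
    (hs : γ ⊆ γ') (h : IsUnit ((cols X γ')ᵀ * cols X γ').det) :
    proj X γ' * proj X γ = proj X γ := by
  conv_lhs => rw [proj.eq_1 X γ, ← Matrix.mul_assoc, ← Matrix.mul_assoc,
    proj_mul_cols_of_subset hs h]
  rfl

theorem proj_mul_proj_of_subset' {X : Matrix (Fin n) (Fin p) ℝ} {γ γ' : Finset (Fin p)}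
    (hs : γ ⊆ γ') (h : IsUnit ((cols X γ')ᵀ * cols X γ').det) :
    proj X γ * proj X γ' = proj X γ := by
  have := congrArg transpose (proj_mul_proj_of_subset hs h)
  rwa [transpose_mul, proj_transpose, proj_transpose] at this

theorem proj_sub_transpose (X : Matrix (Fin n) (Fin p) ℝ) (γ γ' : Finset (Fin p)) :
    (proj X γ' - proj X γ)ᵀ = proj X γ' - proj X γ := by
  rw [transpose_sub, proj_transpose, proj_transpose]

/-- Nested column spaces make the difference a projection too, so its form in Gaussian noise is a
scaled chi-square variable. -/
theorem proj_sub_idem {X : Matrix (Fin n) (Fin p) ℝ} {γ γ' : Finset (Fin p)}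
    (hs : γ ⊆ γ') (h : IsUnit ((cols X γ')ᵀ * cols X γ').det) :
    (proj X γ' - proj X γ) * (proj X γ' - proj X γ) = proj X γ' - proj X γ := by
  rw [Matrix.sub_mul, Matrix.mul_sub, Matrix.mul_sub, proj_mul_self, proj_mul_self,
    proj_mul_proj_of_subset hs h, proj_mul_proj_of_subset' hs h]
  abel

theorem form_proj_mono {X : Matrix (Fin n) (Fin p) ℝ} {γ γ' : Finset (Fin p)}
    (hs : γ ⊆ γ') (h : IsUnit ((cols X γ')ᵀ * cols X γ').det) (v : Fin n → ℝ) :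
    v ⬝ᵥ (proj X γ *ᵥ v) ≤ v ⬝ᵥ (proj X γ' *ᵥ v) := by
  have := form_idem_nonneg (proj_sub_transpose X γ γ') (proj_sub_idem hs h) v
  rw [sub_mulVec, dotProduct_sub] at this
  linarith

/-- Full column rank of the whole design makes every Gram matrix positive definite. -/
theorem gram_posDef {X : Matrix (Fin n) (Fin p) ℝ} (hX : ∀ v, X *ᵥ v = 0 → v = 0)
    (γ : Finset (Fin p)) : ((cols X γ)ᵀ * cols X γ).PosDef := by
  refine PosDef.of_dotProduct_mulVec_pos (isHermitian_of_transpose_eq (gram_transpose X γ))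
    fun v hv => ?_
  rw [star_trivial, dotProduct_gram_mulVec]
  refine lt_of_le_of_ne (dotProduct_self_nonneg' _) fun h => hv ?_
  obtain ⟨b, hb, hb0⟩ := exists_extension γ v
  have h1 := dotProduct_self_eq_zero.1 h.symm
  rw [← hb, cols_mulVec_of_support X hb0] at h1
  rw [← hb, hX b h1]
  rfl

theorem gram_isUnit_det {X : Matrix (Fin n) (Fin p) ℝ} (hX : ∀ v, X *ᵥ v = 0 → v = 0)
    (γ : Finset (Fin p)) : IsUnit ((cols X γ)ᵀ * cols X γ).det :=
  (isUnit_iff_isUnit_det _).1 (gram_posDef hX γ).isUnit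

/-- If one model and its residual complement have positive definite Gram forms, then the
union has linearly independent columns. -/
theorem mulVec_injective_of_forms {X : Matrix (Fin n) (Fin p) ℝ} {γ₀ : Finset (Fin p)}
    {c d : ℝ} (hc : 0 < c) (hd : 0 < d)
    (h₀ : ∀ v : γ₀ → ℝ, c * (v ⬝ᵥ v) ≤ v ⬝ᵥ (((cols X γ₀)ᵀ * cols X γ₀) *ᵥ v))
    (h₁ : ∀ v : (Finset.univ \ γ₀ : Finset (Fin p)) → ℝ, d * (v ⬝ᵥ v) ≤
      v ⬝ᵥ (((cols X (Finset.univ \ γ₀))ᵀ * (1 - proj X γ₀) * cols X (Finset.univ \ γ₀)) *ᵥ v)) :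
    ∀ v, X *ᵥ v = 0 → v = 0 := by
  intro b hb
  have hpd := posDef_of_le_form (gram_transpose X γ₀) hc h₀
  have hu := (isUnit_iff_isUnit_det _).1 hpd.isUnit
  set η : Finset (Fin p) := Finset.univ \ γ₀ with hη
  have hsplit : cols X γ₀ *ᵥ (fun j : γ₀ => b j) + cols X η *ᵥ (fun j : η => b j) = 0 := by
    rw [cols_mulVec_restrict, cols_mulVec_restrict, ← mulVec_add, ← hb]
    congr 1
    funext j
    by_cases hj : j ∈ γ₀ <;> simp [hη, hj]
  have hη0 : (fun j : η => b j) = 0 := by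
    -- Projecting away the columns in `γ₀` isolates the complementary part, whose residual form is
    -- definite.
    have h2 := congrArg (fun w => (1 - proj X γ₀) *ᵥ w) hsplit
    simp only [mulVec_add, mulVec_zero] at h2
    rw [mulVec_mulVec, Matrix.sub_mul, Matrix.one_mul, proj_mul_cols hu, sub_self, zero_mulVec,
      zero_add] at h2
    have h3 := h₁ (fun j : η => b j)
    rw [← mulVec_mulVec, ← mulVec_mulVec, h2, mulVec_zero, dotProduct_zero] at h3
    refine dotProduct_self_eq_zero.1 (le_antisymm ?_ (dotProduct_self_nonneg' _))
    by_contra hlt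
    exact absurd h3 (not_le.2 (mul_pos hd (not_le.1 hlt)))
  have hγ0 : (fun j : γ₀ => b j) = 0 := by
    rw [hη0, mulVec_zero, add_zero] at hsplit
    have h3 := h₀ (fun j : γ₀ => b j)
    rw [dotProduct_gram_mulVec, hsplit, dotProduct_zero] at h3
    refine dotProduct_self_eq_zero.1 (le_antisymm ?_ (dotProduct_self_nonneg' _))
    by_contra hlt
    exact absurd h3 (not_le.2 (mul_pos hc (not_le.1 hlt)))
  funext j
  by_cases hj : j ∈ γ₀
  · exact congrFun hγ0 ⟨j, hj⟩
  · exact congrFun hη0 ⟨j, by simp [hη, hj]⟩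

end Design

/-! ### Determinants and penalized residuals of a model. -/

section RidgeModel

variable {n p : ℕ}

/-- The penalized residual sum of squares `yᵀ (Iₙ - X_γ U_γ⁻¹ X_γᵀ) y`. -/
noncomputable def ridgeRss (c : Fin p → ℝ) (X : Matrix (Fin n) (Fin p) ℝ) (y : Fin n → ℝ)
    (γ : Finset (Fin p)) : ℝ :=
  y ⬝ᵥ ((1 - cols X γ * (uMat c X γ)⁻¹ * (cols X γ)ᵀ) *ᵥ y)

/-- The `n × n` matrix `Iₙ + X_γ Σ_γ X_γᵀ`. -/
noncomputable def margCov (c : Fin p → ℝ) (X : Matrix (Fin n) (Fin p) ℝ)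
    (γ : Finset (Fin p)) : Matrix (Fin n) (Fin n) ℝ :=
  1 + cols X γ * sigmaMat c γ * (cols X γ)ᵀ

theorem sigmaMat_posDef {c : Fin p → ℝ} (hc : ∀ j, 0 < c j) (γ : Finset (Fin p)) :
    (sigmaMat c γ).PosDef := PosDef.diagonal fun j => hc j

theorem sigmaMat_inv {c : Fin p → ℝ} (hc : ∀ j, 0 < c j) (γ : Finset (Fin p)) :
    (sigmaMat c γ)⁻¹ = diagonal fun j : γ => (c j)⁻¹ := by
  refine inv_eq_left_inv ?_
  rw [sigmaMat, diagonal_mul_diagonal, ← diagonal_one]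
  congr 1
  funext j
  exact inv_mul_cancel₀ (hc j).ne'

theorem sigmaSqrt_mul_self {c : Fin p → ℝ} (hc : ∀ j, 0 < c j) (γ : Finset (Fin p)) :
    sigmaSqrt c γ * sigmaSqrt c γ = sigmaMat c γ := by
  rw [sigmaSqrt, diagonal_mul_diagonal, sigmaMat]
  congr 1
  funext j
  exact Real.mul_self_sqrt (hc j).le

theorem sigmaSqrt_transpose (c : Fin p → ℝ) (γ : Finset (Fin p)) :
    (sigmaSqrt c γ)ᵀ = sigmaSqrt c γ := by rw [sigmaSqrt, diagonal_transpose]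

theorem wMat_eq {c : Fin p → ℝ} (hc : ∀ j, 0 < c j) (X : Matrix (Fin n) (Fin p) ℝ)
    (γ : Finset (Fin p)) :
    wMat c X γ = 1 + (cols X γ * sigmaSqrt c γ)ᵀ * (cols X γ * sigmaSqrt c γ) := by
  have h1 : sigmaSqrt c γ * (sigmaMat c γ)⁻¹ * sigmaSqrt c γ = 1 := by
    rw [sigmaMat_inv hc, sigmaSqrt, diagonal_mul_diagonal, diagonal_mul_diagonal, ← diagonal_one]
    congr 1
    funext j
    have h := Real.mul_self_sqrt (hc j).le
    have h' := (hc j).ne'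
    rw [mul_right_comm, h, mul_inv_cancel₀ h']
  rw [wMat, uMat, Matrix.mul_add, Matrix.add_mul, h1, transpose_mul, sigmaSqrt_transpose]
  simp only [Matrix.mul_assoc]

theorem form_wMat {c : Fin p → ℝ} (hc : ∀ j, 0 < c j) (X : Matrix (Fin n) (Fin p) ℝ)
    (γ : Finset (Fin p)) (v : γ → ℝ) :
    v ⬝ᵥ (wMat c X γ *ᵥ v) = v ⬝ᵥ v + (sigmaSqrt c γ *ᵥ v) ⬝ᵥ
      (((cols X γ)ᵀ * cols X γ) *ᵥ (sigmaSqrt c γ *ᵥ v)) := by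
  rw [wMat_eq hc, add_mulVec, one_mulVec, dotProduct_add, dotProduct_gram_mulVec,
    dotProduct_gram_mulVec, mulVec_mulVec]

theorem wMat_posDef {c : Fin p → ℝ} (hc : ∀ j, 0 < c j) (X : Matrix (Fin n) (Fin p) ℝ)
    (γ : Finset (Fin p)) : (wMat c X γ).PosDef := by
  rw [wMat_eq hc]
  exact ridge_posDef PosDef.one _

theorem one_le_det_wMat {c : Fin p → ℝ} (hc : ∀ j, 0 < c j) (X : Matrix (Fin n) (Fin p) ℝ)
    (γ : Finset (Fin p)) : 1 ≤ (wMat c X γ).det := by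
  refine (one_pow (Fintype.card γ)).symm.le.trans (pow_card_le_det
    (posDef_transpose_eq (wMat_posDef hc X γ)) zero_le_one fun v => ?_)
  rw [form_wMat hc, one_mul, dotProduct_gram_mulVec]
  exact le_add_of_nonneg_right (dotProduct_self_nonneg' _)

theorem sigmaSqrt_form_le {c : Fin p → ℝ} (hc : ∀ j, 0 < c j) {t : ℝ} (ht : ∀ j, c j ≤ t)
    (γ : Finset (Fin p)) (v : γ → ℝ) :
    (sigmaSqrt c γ *ᵥ v) ⬝ᵥ (sigmaSqrt c γ *ᵥ v) ≤ t * (v ⬝ᵥ v) := by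
  simp only [dotProduct, sigmaSqrt, mulVec_diagonal, Finset.mul_sum]
  refine Finset.sum_le_sum fun j _ => ?_
  rw [mul_mul_mul_comm, Real.mul_self_sqrt (hc j).le]
  exact mul_le_mul_of_nonneg_right (ht j) (mul_self_nonneg _)

theorem le_sigmaSqrt_form {c : Fin p → ℝ} (hc : ∀ j, 0 < c j) {t : ℝ} (ht : ∀ j, t ≤ c j)
    (γ : Finset (Fin p)) (v : γ → ℝ) :
    t * (v ⬝ᵥ v) ≤ (sigmaSqrt c γ *ᵥ v) ⬝ᵥ (sigmaSqrt c γ *ᵥ v) := by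
  simp only [dotProduct, sigmaSqrt, mulVec_diagonal, Finset.mul_sum]
  refine Finset.sum_le_sum fun j _ => ?_
  rw [mul_mul_mul_comm, Real.mul_self_sqrt (hc j).le]
  exact mul_le_mul_of_nonneg_right (ht j) (mul_self_nonneg _)

theorem det_wMat_le {c : Fin p → ℝ} (hc : ∀ j, 0 < c j) {t g : ℝ} (ht : ∀ j, c j ≤ t)
    (hg : 0 ≤ g) {X : Matrix (Fin n) (Fin p) ℝ} {γ : Finset (Fin p)}
    (h : ∀ v : γ → ℝ, v ⬝ᵥ (((cols X γ)ᵀ * cols X γ) *ᵥ v) ≤ g * (v ⬝ᵥ v)) :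
    (wMat c X γ).det ≤ (1 + g * t) ^ γ.card := by
  rw [← Fintype.card_coe γ]
  refine det_le_pow_card (wMat_posDef hc X γ).posSemidef fun v => ?_
  rw [form_wMat hc, add_mul, one_mul, mul_assoc]
  refine add_le_add le_rfl ((h _).trans (mul_le_mul_of_nonneg_left ?_ hg))
  exact sigmaSqrt_form_le hc ht γ v

/-- Sylvester's identity. Unlike `wMat`, the matrix `margCov` has the same size for all models, so
nested models can be compared. -/
theorem det_margCov {c : Fin p → ℝ} (hc : ∀ j, 0 < c j) (X : Matrix (Fin n) (Fin p) ℝ)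
    (γ : Finset (Fin p)) : (margCov c X γ).det = (wMat c X γ).det := by
  rw [wMat_eq hc, det_one_add_mul_comm, margCov, transpose_mul, sigmaSqrt_transpose,
    ← sigmaSqrt_mul_self hc]
  simp only [Matrix.mul_assoc]

theorem uMat_posDef {c : Fin p → ℝ} (hc : ∀ j, 0 < c j) (X : Matrix (Fin n) (Fin p) ℝ)
    (γ : Finset (Fin p)) : (uMat c X γ).PosDef :=
  ridge_posDef (sigmaMat_posDef hc γ).inv _

/-- Woodbury's identity. It links the determinant and the residual: the form in `ridgeRss` is the
inverse of `margCov`. -/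
theorem margCov_inv {c : Fin p → ℝ} (hc : ∀ j, 0 < c j) (X : Matrix (Fin n) (Fin p) ℝ)
    (γ : Finset (Fin p)) :
    (margCov c X γ)⁻¹ = 1 - cols X γ * (uMat c X γ)⁻¹ * (cols X γ)ᵀ := by
  refine inv_eq_right_inv ?_
  have hU := (isUnit_iff_isUnit_det _).1 (uMat_posDef hc X γ).isUnit
  have hS := (isUnit_iff_isUnit_det _).1 (sigmaMat_posDef hc γ).isUnit
  have h1 : sigmaMat c γ * ((cols X γ)ᵀ * cols X γ) = sigmaMat c γ * uMat c X γ - 1 := by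
    rw [uMat, Matrix.mul_add, mul_nonsing_inv _ hS, add_sub_cancel_left]
  have h2 : sigmaMat c γ * ((cols X γ)ᵀ * cols X γ) * (uMat c X γ)⁻¹ =
      sigmaMat c γ - (uMat c X γ)⁻¹ := by
    rw [h1, Matrix.sub_mul, Matrix.mul_assoc, mul_nonsing_inv _ hU, Matrix.mul_one,
      Matrix.one_mul]
  have h3 : cols X γ * sigmaMat c γ * (cols X γ)ᵀ * (cols X γ * (uMat c X γ)⁻¹ * (cols X γ)ᵀ) =
      cols X γ * (sigmaMat c γ * ((cols X γ)ᵀ * cols X γ) * (uMat c X γ)⁻¹) * (cols X γ)ᵀ := by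
    simp only [Matrix.mul_assoc]
  rw [margCov, Matrix.add_mul, Matrix.one_mul, Matrix.mul_sub, Matrix.mul_one, h3, h2,
    Matrix.mul_sub, Matrix.sub_mul]
  abel

theorem margCov_posDef {c : Fin p → ℝ} (hc : ∀ j, 0 < c j) (X : Matrix (Fin n) (Fin p) ℝ)
    (γ : Finset (Fin p)) : (margCov c X γ).PosDef := by
  refine PosDef.one.add_posSemidef ?_
  have := (sigmaMat_posDef hc γ).posSemidef.mul_mul_conjTranspose_same (cols X γ)
  rwa [conjTranspose_eq_transpose_of_trivial] at this

theorem ridgeRss_nonneg {c : Fin p → ℝ} (hc : ∀ j, 0 < c j) (X : Matrix (Fin n) (Fin p) ℝ)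
    (y : Fin n → ℝ) (γ : Finset (Fin p)) : 0 ≤ ridgeRss c X y γ := by
  rw [ridgeRss, ← margCov_inv hc]
  simpa using (margCov_posDef hc X γ).inv.posSemidef.dotProduct_mulVec_nonneg y

theorem ridgeRss_le {c : Fin p → ℝ} (hc : ∀ j, 0 < c j) {t : ℝ} (ht0 : 0 < t)
    (ht : ∀ j, t ≤ c j) (X : Matrix (Fin n) (Fin p) ℝ)
    (y : Fin n → ℝ) (γ : Finset (Fin p)) (b : γ → ℝ) :
    ridgeRss c X y γ ≤ (y - cols X γ *ᵥ b) ⬝ᵥ (y - cols X γ *ᵥ b) + (b ⬝ᵥ b) / t := by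
  refine (ridge_le (sigmaMat_posDef hc γ).inv (cols X γ) y b).trans (add_le_add le_rfl ?_)
  rw [sigmaMat_inv hc]
  simp only [dotProduct, mulVec_diagonal, Finset.sum_div]
  refine Finset.sum_le_sum fun j _ => ?_
  rw [mul_left_comm, div_eq_inv_mul]
  exact mul_le_mul_of_nonneg_right (inv_anti₀ ht0 (ht j)) (mul_self_nonneg _)

theorem le_ridgeRss {c : Fin p → ℝ} (hc : ∀ j, 0 < c j) {X : Matrix (Fin n) (Fin p) ℝ}
    (y : Fin n → ℝ) {γ : Finset (Fin p)} (h : IsUnit ((cols X γ)ᵀ * cols X γ).det) :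
    y ⬝ᵥ ((1 - proj X γ) *ᵥ y) ≤ ridgeRss c X y γ :=
  le_ridge (sigmaMat_posDef hc γ).inv _ y (proj_transpose X γ) (proj_mul_self X γ)
    (proj_mul_cols h)

theorem margCov_eq_add (c : Fin p → ℝ) (X : Matrix (Fin n) (Fin p) ℝ)
    {γ₀ γ : Finset (Fin p)} (h : γ₀ ⊆ γ) :
    margCov c X γ = margCov c X γ₀ +
      cols X (γ \ γ₀) * sigmaMat c (γ \ γ₀) * (cols X (γ \ γ₀))ᵀ := by
  have key : ∀ s : Finset (Fin p), cols X s * sigmaMat c s * (cols X s)ᵀ =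
      Matrix.of fun i k => ∑ j ∈ s, X i j * c j * X k j := by
    intro s
    ext i k
    rw [mul_apply]
    simp only [sigmaMat, mul_diagonal, transpose_apply, cols, submatrix_apply, id, of_apply]
    exact Finset.sum_coe_sort s fun j => X i j * c j * X k j
  rw [margCov, margCov, key, key, key, add_assoc]
  congr 1
  ext i k
  simp only [Matrix.add_apply, of_apply]
  exact (add_comm _ _).trans (Finset.sum_sdiff h) |>.symm

/-- Passing from `γ₀` to `γ` adds `B Bᵀ` to `margCov`, where `B` holds the scaled new columns, so
the determinant gains the factor `det (1 + Bᵀ M⁻¹ B)` with `M = margCov c X γ₀`. By Woodbury the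
form of `M⁻¹` is the penalized residual, which dominates the least-squares residual; each new column
therefore contributes at least `g * t`. -/
theorem det_wMat_mul_le {c : Fin p → ℝ} (hc : ∀ j, 0 < c j) {t g : ℝ} (ht0 : 0 ≤ t)
    (ht : ∀ j, t ≤ c j) (hg : 0 ≤ g) {X : Matrix (Fin n) (Fin p) ℝ} {γ₀ γ : Finset (Fin p)}
    (hs : γ₀ ⊆ γ) (hu : IsUnit ((cols X γ₀)ᵀ * cols X γ₀).det)
    (h : ∀ v : (γ \ γ₀ : Finset (Fin p)) → ℝ, g * (v ⬝ᵥ v) ≤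
      v ⬝ᵥ (((cols X (γ \ γ₀))ᵀ * (1 - proj X γ₀) * cols X (γ \ γ₀)) *ᵥ v)) :
    (wMat c X γ₀).det * (g * t) ^ (γ \ γ₀).card ≤ (wMat c X γ).det := by
  set η := γ \ γ₀
  have hM := margCov_posDef hc X γ₀
  have hB : cols X η * sigmaMat c η * (cols X η)ᵀ =
      (cols X η * sigmaSqrt c η) * (cols X η * sigmaSqrt c η)ᵀ := by
    rw [transpose_mul, sigmaSqrt_transpose, ← sigmaSqrt_mul_self hc]
    simp only [Matrix.mul_assoc]
  have hMt := posDef_transpose_eq hM.inv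
  rw [← det_margCov hc X γ, margCov_eq_add c X hs, hB,
    det_add_mul _ _ ((isUnit_iff_isUnit_det _).1 hM.isUnit), det_margCov hc]
  refine mul_le_mul_of_nonneg_left ?_ (zero_le_one.trans (one_le_det_wMat hc X γ₀))
  rw [← Fintype.card_coe η]
  refine pow_card_le_det ?_ (mul_nonneg hg ht0) fun v => ?_
  · rw [transpose_add, transpose_one, transpose_mul _ (cols X η * sigmaSqrt c η),
      transpose_mul (cols X η * sigmaSqrt c η)ᵀ, transpose_transpose, hMt, Matrix.mul_assoc]
  set w := sigmaSqrt c η *ᵥ v with hw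
  have h1 : v ⬝ᵥ ((1 + (cols X η * sigmaSqrt c η)ᵀ * (margCov c X γ₀)⁻¹ *
      (cols X η * sigmaSqrt c η)) *ᵥ v) = v ⬝ᵥ v + ridgeRss c X (cols X η *ᵥ w) γ₀ := by
    rw [add_mulVec, one_mulVec, dotProduct_add, ridgeRss, ← margCov_inv hc, ← mulVec_mulVec,
      ← mulVec_mulVec, dotProduct_mulVec v, vecMul_transpose, ← mulVec_mulVec, ← hw]
  have h2 : w ⬝ᵥ (((cols X η)ᵀ * (1 - proj X γ₀) * cols X η) *ᵥ w) =
      (cols X η *ᵥ w) ⬝ᵥ ((1 - proj X γ₀) *ᵥ (cols X η *ᵥ w)) := by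
    rw [← mulVec_mulVec, ← mulVec_mulVec, dotProduct_mulVec w, vecMul_transpose]
  rw [h1]
  have h3 := (h w).trans (h2.le.trans (le_ridgeRss hc (cols X η *ᵥ w) hu))
  have h4 := mul_le_mul_of_nonneg_left (le_sigmaSqrt_form hc ht η v) hg
  rw [← hw, ← mul_assoc] at h4
  have h5 := dotProduct_self_nonneg' v
  linarith

end RidgeModel

/-! ### Penalized residuals of true, overfitted and underfitted models. -/

section Residuals

variable {n p : ℕ}

theorem stateOf_support (β : Fin p → ℝ) : ∀ j ∉ stateOf β, β j = 0 := by
  intro j hj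
  by_contra h
  exact hj (by simp [stateOf, h])

theorem cols_stateOf_mulVec (X : Matrix (Fin n) (Fin p) ℝ) {β : Fin p → ℝ}
    {γ : Finset (Fin p)} (h : stateOf β ⊆ γ) : cols X γ *ᵥ (fun j : γ => β j) = X *ᵥ β :=
  cols_mulVec_of_support X fun j hj => stateOf_support β j fun h' => hj (h h')

theorem dotProduct_restrict_stateOf (β : Fin p → ℝ) :
    (fun j : stateOf β => β j) ⬝ᵥ (fun j : stateOf β => β j) = ∑ j ∈ stateOf β, β j ^ 2 := by
  simp only [dotProduct, ← sq]
  exact Finset.sum_coe_sort (stateOf β) fun j => β j ^ 2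

theorem dotProduct_add_self_le {m : Type*} [Fintype m] (a b : m → ℝ) :
    (a + b) ⬝ᵥ (a + b) ≤ 2 * (a ⬝ᵥ a) + 2 * (b ⬝ᵥ b) := by
  simp only [dotProduct, Finset.mul_sum, ← Finset.sum_add_distrib, Pi.add_apply]
  exact Finset.sum_le_sum fun i _ => by nlinarith [sq_nonneg (a i - b i)]

/-- Upper bound for the penalized residual sum of squares of the true model. -/
theorem ridgeRss_true_le {c : Fin p → ℝ} (hc : ∀ j, 0 < c j) {t g : ℝ} (ht0 : 0 < t)
    (ht : ∀ j, t ≤ c j) (hg : 0 < g) {X : Matrix (Fin n) (Fin p) ℝ} {β : Fin p → ℝ}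
    (hgram : ∀ v : stateOf β → ℝ,
      g * (v ⬝ᵥ v) ≤ v ⬝ᵥ (((cols X (stateOf β))ᵀ * cols X (stateOf β)) *ᵥ v))
    (e : Fin n → ℝ) :
    ridgeRss c X (X *ᵥ β + e) (stateOf β) ≤ e ⬝ᵥ ((1 - proj X (stateOf β)) *ᵥ e) +
      (2 * ∑ j ∈ stateOf β, β j ^ 2 + 2 * (e ⬝ᵥ e / g)) / t := by
  set γ := stateOf β
  set A := cols X γ with hA
  -- The ridge criterion is evaluated at the least-squares coefficient `β + z`: the residual there
  -- is `(1 - P) e`, and the penalty is controlled by `|β|²` and `|z|²`.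
  set z := (Aᵀ * A)⁻¹ *ᵥ (Aᵀ *ᵥ e) with hz
  have hAz : A *ᵥ z = proj X γ *ᵥ e := by
    rw [hz, proj, ← mulVec_mulVec, ← mulVec_mulVec]
  have h1 := ridgeRss_le hc ht0 ht X (X *ᵥ β + e) γ ((fun j : γ => β j) + z)
  have h2 : X *ᵥ β + e - A *ᵥ ((fun j : γ => β j) + z) = (1 - proj X γ) *ᵥ e := by
    rw [mulVec_add, hAz, hA, cols_stateOf_mulVec X (Finset.Subset.refl _), sub_mulVec,
      one_mulVec]
    abel
  rw [← hA, h2, dotProduct_of_idem (one_sub_symm (proj_transpose X γ))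
    (one_sub_idem (proj_mul_self X γ))] at h1
  refine h1.trans (add_le_add le_rfl (div_le_div_of_nonneg_right ?_ ht0.le))
  refine (dotProduct_add_self_le _ _).trans ?_
  rw [dotProduct_restrict_stateOf]
  have h3 : z ⬝ᵥ z ≤ e ⬝ᵥ e / g := by
    rw [le_div_iff₀ hg, mul_comm]
    refine (hgram z).trans ?_
    rw [dotProduct_gram_mulVec, hAz, dotProduct_of_idem (proj_transpose X γ) (proj_mul_self X γ)]
    exact form_idem_le (proj_transpose X γ) (proj_mul_self X γ) e
  linarith

/-- Lower bound for the penalized residual sum of squares of a model containing the true one. -/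
theorem le_ridgeRss_of_subset {c : Fin p → ℝ} (hc : ∀ j, 0 < c j)
    {X : Matrix (Fin n) (Fin p) ℝ} {β : Fin p → ℝ} {γ : Finset (Fin p)} (hs : stateOf β ⊆ γ)
    (hu : IsUnit ((cols X γ)ᵀ * cols X γ).det) (e : Fin n → ℝ) :
    e ⬝ᵥ ((1 - proj X γ) *ᵥ e) ≤ ridgeRss c X (X *ᵥ β + e) γ := by
  have h1 := le_ridgeRss hc (X *ᵥ β + e) hu
  have h2 : (1 - proj X γ) *ᵥ (X *ᵥ β + e) = (1 - proj X γ) *ᵥ e := by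
    rw [mulVec_add, ← cols_stateOf_mulVec X hs, mulVec_mulVec, Matrix.sub_mul, Matrix.one_mul,
      proj_mul_cols hu, sub_self, zero_mulVec, zero_add]
  rwa [← dotProduct_of_idem (one_sub_symm (proj_transpose X γ))
    (one_sub_idem (proj_mul_self X γ)), h2, dotProduct_of_idem
    (one_sub_symm (proj_transpose X γ)) (one_sub_idem (proj_mul_self X γ))] at h1

/-- Lower bound for the penalized residual sum of squares of a model that misses some true
coefficient. -/
theorem le_ridgeRss_of_not_subset {c : Fin p → ℝ} (hc : ∀ j, 0 < c j)
    {X : Matrix (Fin n) (Fin p) ℝ} (hX : ∀ v, X *ᵥ v = 0 → v = 0) {β : Fin p → ℝ}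
    {γ : Finset (Fin p)} (hs : ¬ stateOf β ⊆ γ) {g m : ℝ} (hg : 0 ≤ g) (hm : 0 ≤ m)
    (hβ : ∀ j ∈ stateOf β, m ≤ |β j|)
    (h : ∀ v : (stateOf β \ γ : Finset (Fin p)) → ℝ, g * (v ⬝ᵥ v) ≤
      v ⬝ᵥ (((cols X (stateOf β \ γ))ᵀ * (1 - proj X γ) * cols X (stateOf β \ γ)) *ᵥ v))
    (e : Fin n → ℝ) :
    e ⬝ᵥ e + g * m ^ 2 / 2 - 3 * (e ⬝ᵥ (proj X Finset.univ *ᵥ e)) ≤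
      ridgeRss c X (X *ᵥ β + e) γ := by
  set η := stateOf β \ γ with hη
  have hu := gram_isUnit_det hX γ
  have huniv := gram_isUnit_det hX Finset.univ
  set P := proj X Finset.univ with hP
  have hsymm := one_sub_symm (proj_transpose X γ)
  have hidem := one_sub_idem (proj_mul_self X γ)
  set x := cols X η *ᵥ (fun j : η => β j) with hx
  -- The part of the missed signal that the columns in `γ` cannot imitate.
  set w := (1 - proj X γ) *ᵥ x with hw
  have hsplit : X *ᵥ β = cols X γ *ᵥ (fun j : γ => β j) + x := by
    rw [hx, cols_mulVec_restrict, cols_mulVec_restrict, ← mulVec_add]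
    congr 1
    funext j
    by_cases h1 : j ∈ γ
    · simp [hη, h1]
    · by_cases h2 : j ∈ stateOf β
      · simp [hη, h1, h2]
      · simp [hη, h1, h2, stateOf_support β j h2]
  have h2 : (1 - proj X γ) *ᵥ (X *ᵥ β + e) = w + (1 - proj X γ) *ᵥ e := by
    rw [hsplit, add_assoc, mulVec_add, mulVec_mulVec, Matrix.sub_mul, Matrix.one_mul,
      proj_mul_cols hu, sub_self, zero_mulVec, zero_add, mulVec_add]
  have h1 := le_ridgeRss hc (X *ᵥ β + e) hu
  have hww : (1 - proj X γ) *ᵥ w = w := by rw [hw, mulVec_mulVec, hidem]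
  have hwe : w ⬝ᵥ ((1 - proj X γ) *ᵥ e) = w ⬝ᵥ e := by
    rw [dotProduct_mulVec, ← mulVec_transpose, hsymm, hww]
  rw [← dotProduct_of_idem hsymm hidem, h2, add_dotProduct, dotProduct_add, dotProduct_add,
    dotProduct_comm ((1 - proj X γ) *ᵥ e) w, hwe, dotProduct_of_idem hsymm hidem e, sub_mulVec,
    one_mulVec, dotProduct_sub] at h1
  -- `w` lies in the column space of `X`, so it interacts only with `P e`. Its squared length is of
  -- order `p`, not `n`, which keeps the cross term harmless.
  have hPw : P *ᵥ w = w := by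
    rw [hw, hx, mulVec_mulVec, mulVec_mulVec, Matrix.mul_sub, Matrix.mul_one, Matrix.sub_mul,
      proj_mul_cols_of_subset (Finset.subset_univ _) huniv,
      proj_mul_proj_of_subset (Finset.subset_univ _) huniv, mulVec_mulVec, Matrix.sub_mul,
      Matrix.one_mul]
  have hPe : w ⬝ᵥ e = w ⬝ᵥ (P *ᵥ e) := by
    conv_lhs => rw [← hPw]
    rw [dotProduct_mulVec w, ← mulVec_transpose, proj_transpose]
  have hmono := form_proj_mono (Finset.subset_univ γ) huniv e
  rw [← hP] at hmono
  have hlow : g * m ^ 2 ≤ w ⬝ᵥ w := by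
    have h3 := h fun j : η => β j
    rw [← mulVec_mulVec, ← mulVec_mulVec, dotProduct_mulVec, vecMul_transpose, ← hx,
      ← dotProduct_of_idem hsymm hidem, ← hw] at h3
    refine le_trans (mul_le_mul_of_nonneg_left ?_ hg) h3
    obtain ⟨j, hj, hjγ⟩ := Finset.not_subset.1 hs
    have hjη : j ∈ η := by simp [hη, hj, hjγ]
    have h4 : m ^ 2 ≤ β j * β j := by
      rw [← abs_mul_abs_self (β j), sq]
      exact mul_self_le_mul_self hm (hβ j hj)
    exact h4.trans (Finset.single_le_sum (f := fun j : η => β j * β j)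
      (fun i _ => mul_self_nonneg _) (Finset.mem_univ (⟨j, hjη⟩ : η)))
  -- Expand `0 ≤ |w/2 + P e|²`. This costs two of the three units of `e ⬝ᵥ P e` in the conclusion;
  -- `hmono` costs the third.
  have hcross : -(w ⬝ᵥ w / 2 + 2 * (e ⬝ᵥ (P *ᵥ e))) ≤ 2 * (w ⬝ᵥ e) := by
    have h5 := dotProduct_self_nonneg' ((1 / 2 : ℝ) • w + P *ᵥ e)
    simp only [add_dotProduct, dotProduct_add, smul_dotProduct, dotProduct_smul,
      smul_eq_mul] at h5
    rw [dotProduct_comm (P *ᵥ e) w, ← hPe, dotProduct_of_idem (proj_transpose X _)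
      (proj_mul_self X _)] at h5
    linarith
  linarith

end Residuals

/-! ### Posterior odds. -/

section Posterior

variable {n p : ℕ}

theorem postWeight_eq (ν : ℝ) (prior : PMF (Finset (Fin p))) (c : Fin p → ℝ)
    (X : Matrix (Fin n) (Fin p) ℝ) (y : Fin n → ℝ) (γ : Finset (Fin p)) :
    postWeight ν prior c X y γ = (2 * Real.pi) ^ (-(n : ℝ) / 2) *
      (wMat c X γ).det ^ (-(1 / 2) : ℝ) * (prior γ).toReal *
      (2 / (1 + ridgeRss c X y γ)) ^ (((n : ℝ) + ν) / 2) := rfl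

theorem postWeight_nonneg (ν : ℝ) (prior : PMF (Finset (Fin p))) {c : Fin p → ℝ}
    (hc : ∀ j, 0 < c j) (X : Matrix (Fin n) (Fin p) ℝ) (y : Fin n → ℝ) (γ : Finset (Fin p)) :
    0 ≤ postWeight ν prior c X y γ := by
  rw [postWeight_eq]
  have h1 := ridgeRss_nonneg hc X y γ
  have h2 := one_le_det_wMat hc X γ
  have h3 := Real.pi_pos
  positivity

theorem postWeight_pos (ν : ℝ) {prior : PMF (Finset (Fin p))} {c : Fin p → ℝ}
    (hc : ∀ j, 0 < c j) (X : Matrix (Fin n) (Fin p) ℝ) (y : Fin n → ℝ) {γ : Finset (Fin p)}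
    (hp : prior γ ≠ 0) : 0 < postWeight ν prior c X y γ := by
  rw [postWeight_eq]
  have h1 := ridgeRss_nonneg hc X y γ
  have h2 := one_le_det_wMat hc X γ
  have h3 := Real.pi_pos
  have h4 : 0 < (prior γ).toReal := ENNReal.toReal_pos hp (prior.apply_ne_top γ)
  have h5 : 0 < (wMat c X γ).det := by linarith
  positivity

theorem postWeight_le_mul {ν : ℝ} (hν : 0 < ν) {prior : PMF (Finset (Fin p))}
    {c : Fin p → ℝ} (hc : ∀ j, 0 < c j) {X : Matrix (Fin n) (Fin p) ℝ} {y : Fin n → ℝ}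
    {γ₀ γ : Finset (Fin p)} {C d ρ : ℝ} (hd : 0 < d) (hρ : 0 ≤ ρ)
    (hprior : (prior γ).toReal ≤ C * (prior γ₀).toReal)
    (hdet : (wMat c X γ₀).det * d ≤ (wMat c X γ).det)
    (hrss : 1 + ridgeRss c X y γ₀ ≤ ρ * (1 + ridgeRss c X y γ)) :
    postWeight ν prior c X y γ ≤
      postWeight ν prior c X y γ₀ * (C * d ^ (-(1 / 2) : ℝ) * ρ ^ (((n : ℝ) + ν) / 2)) := by
  rw [postWeight_eq, postWeight_eq]
  have h0 := ridgeRss_nonneg hc X y γ₀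
  have h1 := ridgeRss_nonneg hc X y γ
  have hd0 := one_le_det_wMat hc X γ₀
  have hpi := Real.pi_pos
  have e1 : (wMat c X γ).det ^ (-(1 / 2) : ℝ) ≤
      (wMat c X γ₀).det ^ (-(1 / 2) : ℝ) * d ^ (-(1 / 2) : ℝ) := by
    rw [← Real.mul_rpow (by linarith) hd.le]
    exact Real.rpow_le_rpow_of_nonpos (by positivity) hdet (by norm_num)
  have e2 : (2 / (1 + ridgeRss c X y γ)) ^ (((n : ℝ) + ν) / 2) ≤
      (2 / (1 + ridgeRss c X y γ₀)) ^ (((n : ℝ) + ν) / 2) * ρ ^ (((n : ℝ) + ν) / 2) := by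
    rw [← Real.mul_rpow (by positivity) hρ]
    refine Real.rpow_le_rpow (by positivity) ?_ (by positivity)
    rw [div_mul_eq_mul_div, div_le_div_iff₀ (by positivity) (by positivity)]
    nlinarith
  have h2 := one_le_det_wMat hc X γ
  have h3 : 0 ≤ (prior γ).toReal := ENNReal.toReal_nonneg
  calc _ ≤ (2 * Real.pi) ^ (-(n : ℝ) / 2) *
      ((wMat c X γ₀).det ^ (-(1 / 2) : ℝ) * d ^ (-(1 / 2) : ℝ)) * (C * (prior γ₀).toReal) *
      ((2 / (1 + ridgeRss c X y γ₀)) ^ (((n : ℝ) + ν) / 2) * ρ ^ (((n : ℝ) + ν) / 2)) := by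
        gcongr
        exact mul_nonneg (by positivity) (h3.trans hprior)
    _ = _ := by ring

theorem posterior_le_one (ν : ℝ) (prior : PMF (Finset (Fin p))) {c : Fin p → ℝ}
    (hc : ∀ j, 0 < c j) (X : Matrix (Fin n) (Fin p) ℝ) (y : Fin n → ℝ) (γ : Finset (Fin p)) :
    posterior ν prior c X y γ ≤ 1 :=
  div_le_one_of_le₀ (Finset.single_le_sum (fun γ' _ => postWeight_nonneg ν prior hc X y γ')
    (Finset.mem_univ γ)) (Finset.sum_nonneg fun γ' _ => postWeight_nonneg ν prior hc X y γ')

/-- When the odds sum to at most `T`, the posterior is at least `1 / (1 + T) ≥ 1 - T`. -/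
theorem le_posterior {ν : ℝ} {prior : PMF (Finset (Fin p))} {c : Fin p → ℝ}
    (hc : ∀ j, 0 < c j) {X : Matrix (Fin n) (Fin p) ℝ} {y : Fin n → ℝ} {γ₀ : Finset (Fin p)}
    (hp : prior γ₀ ≠ 0) {r : Finset (Fin p) → ℝ}
    (h : ∀ γ, γ ≠ γ₀ → postWeight ν prior c X y γ ≤ postWeight ν prior c X y γ₀ * r γ)
    {T : ℝ} (hT : ∑ γ ∈ Finset.univ.erase γ₀, r γ ≤ T) :
    1 - T ≤ posterior ν prior c X y γ₀ := by
  have hpos := postWeight_pos ν hc X y hp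
  set w := postWeight ν prior c X y
  have hsum : ∑ γ, w γ ≤ w γ₀ * (1 + T) := by
    rw [← Finset.add_sum_erase _ _ (Finset.mem_univ γ₀), mul_add, mul_one]
    refine add_le_add le_rfl ((Finset.sum_le_sum fun γ hγ => h γ (Finset.ne_of_mem_erase hγ)).trans
      ?_)
    rw [← Finset.mul_sum]
    exact mul_le_mul_of_nonneg_left hT hpos.le
  have hsumpos : 0 < ∑ γ, w γ :=
    hpos.trans_le (Finset.single_le_sum (fun γ' _ => postWeight_nonneg ν prior hc X y γ')
      (Finset.mem_univ γ₀))
  change 1 - T ≤ w γ₀ / ∑ γ, w γ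
  rw [le_div_iff₀ hsumpos]
  by_cases hT1 : T ≤ 1
  · nlinarith [mul_le_mul_of_nonneg_left hsum (sub_nonneg.2 hT1),
      mul_nonneg hpos.le (sq_nonneg T)]
  · nlinarith

end Posterior

/-! ### Exponential moments of Gaussian quadratic forms. -/

section Gaussian

/-- Negative `t` is allowed; the lower tail of `|e|²` needs it. -/
theorem lintegral_exp_sq_gaussianReal {v : ℝ≥0} (hv : 0 < v) {t : ℝ} (ht : 2 * t * v < 1) :
    ∫⁻ x, ENNReal.ofReal (Real.exp (t * x ^ 2)) ∂gaussianReal 0 v =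
      ENNReal.ofReal ((1 - 2 * t * v) ^ (-(1 / 2) : ℝ)) := by
  have hv' : (0 : ℝ) < v := NNReal.coe_pos.2 hv
  have hpi := Real.pi_pos
  set b : ℝ := 1 / (2 * v) - t with hb
  have hbv : 2 * v * b = 1 - 2 * t * v := by rw [hb]; field_simp
  have hbpos : 0 < b := by
    by_contra h
    nlinarith [mul_nonneg hv'.le (neg_nonneg.2 (not_lt.1 h))]
  rw [gaussianReal_of_var_ne_zero _ hv.ne', lintegral_withDensity_eq_lintegral_mul _
    (measurable_gaussianPDF _ _) (by fun_prop)]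
  have h1 : ∀ x : ℝ, (gaussianPDF 0 v * fun x => ENNReal.ofReal (Real.exp (t * x ^ 2))) x =
      ENNReal.ofReal ((√(2 * Real.pi * v))⁻¹ * Real.exp (-b * x ^ 2)) := by
    intro x
    rw [Pi.mul_apply, gaussianPDF, ← ENNReal.ofReal_mul (gaussianPDFReal_nonneg _ _ _),
      gaussianPDFReal, mul_assoc, ← Real.exp_add]
    congr 3
    rw [hb, sub_zero]
    ring
  simp_rw [h1]
  rw [← ofReal_integral_eq_lintegral_ofReal ((integrable_exp_neg_mul_sq hbpos).const_mul _)
    (ae_of_all _ fun x => by positivity), integral_const_mul, integral_gaussian]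
  congr 1
  rw [Real.rpow_neg (by linarith), ← Real.sqrt_eq_rpow, ← hbv, ← Real.sqrt_inv, ← Real.sqrt_inv,
    ← Real.sqrt_mul (by positivity)]
  congr 1
  field_simp

theorem lintegral_pi_prod_ofReal {ι : Type*} [Fintype ι] {μ : ι → Measure ℝ}
    [∀ i, SigmaFinite (μ i)] {f : ι → ℝ → ℝ} (hf : ∀ i, Measurable (f i)) (hf0 : ∀ i x, 0 ≤ f i x)
    {a : ι → ℝ} (ha : ∀ i, 0 ≤ a i)
    (h : ∀ i, ∫⁻ x, ENNReal.ofReal (f i x) ∂μ i = ENNReal.ofReal (a i)) :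
    ∫⁻ x, ENNReal.ofReal (∏ i, f i (x i)) ∂Measure.pi μ = ENNReal.ofReal (∏ i, a i) := by
  have hint : ∀ i, Integrable (f i) (μ i) := fun i =>
    ⟨(hf i).aestronglyMeasurable, by
      rw [hasFiniteIntegral_iff_ofReal (ae_of_all _ (hf0 i)), h i]
      exact ENNReal.ofReal_lt_top⟩
  have hval : ∀ i, ∫ x, f i x ∂μ i = a i := fun i => by
    rw [integral_eq_lintegral_of_nonneg_ae (ae_of_all _ (hf0 i)) (hf i).aestronglyMeasurable,
      h i, ENNReal.toReal_ofReal (ha i)]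
  rw [← ofReal_integral_eq_lintegral_ofReal (Integrable.fintype_prod hint)
    (ae_of_all _ fun x => Finset.prod_nonneg fun i _ => hf0 i _), integral_fintype_prod_eq_prod]
  simp_rw [hval]

variable {m : Type*} [Fintype m] [DecidableEq m]

theorem lintegral_exp_dotProduct_gaussian (v : ℝ≥0) (a : m → ℝ) :
    ∫⁻ x, ENNReal.ofReal (Real.exp (a ⬝ᵥ x)) ∂Measure.pi (fun _ : m => gaussianReal 0 v) =
      ENNReal.ofReal (Real.exp (v * (a ⬝ᵥ a) / 2)) := by
  have h : ∀ i, ∫⁻ x, ENNReal.ofReal (Real.exp (a i * x)) ∂gaussianReal 0 v =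
      ENNReal.ofReal (Real.exp (v * a i ^ 2 / 2)) := fun i => by
    rw [← ofReal_integral_eq_lintegral_ofReal (integrable_exp_mul_gaussianReal _)
      (ae_of_all _ fun x => (Real.exp_pos _).le)]
    have := congrFun (mgf_fun_id_gaussianReal (μ := 0) (v := v)) (a i)
    rw [mgf] at this
    rw [this, zero_mul, zero_add]
  have h2 := lintegral_pi_prod_ofReal (μ := fun _ : m => gaussianReal 0 v)
    (f := fun i x => Real.exp (a i * x)) (fun i => by fun_prop)
    (fun i x => (Real.exp_pos _).le) (fun i => (Real.exp_pos _).le) h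
  simp only [← Real.exp_sum] at h2
  rw [show v * (a ⬝ᵥ a) / 2 = ∑ i, (v : ℝ) * a i ^ 2 / 2 by
    simp only [dotProduct, Finset.mul_sum, Finset.sum_div, sq]]
  exact h2

theorem lintegral_exp_sum_sq_gaussian {v : ℝ≥0} (hv : 0 < v) {d : m → ℝ}
    (hd : ∀ i, 2 * d i * v < 1) :
    ∫⁻ x, ENNReal.ofReal (Real.exp (∑ i, d i * x i ^ 2))
        ∂Measure.pi (fun _ : m => gaussianReal 0 v) =
      ENNReal.ofReal (∏ i, (1 - 2 * d i * v) ^ (-(1 / 2) : ℝ)) := by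
  have h2 := lintegral_pi_prod_ofReal (μ := fun _ : m => gaussianReal 0 v)
    (f := fun i x => Real.exp (d i * x ^ 2)) (fun i => by fun_prop)
    (fun i x => (Real.exp_pos _).le) (fun i => Real.rpow_nonneg (sub_nonneg.2 (hd i).le) _)
    fun i => lintegral_exp_sq_gaussianReal hv (hd i)
  simp only [← Real.exp_sum] at h2
  exact h2

/-- The moment generating function of the squared length of the projection of a Gaussian vector. -/
theorem lintegral_exp_form_gaussian {v : ℝ≥0} (hv : 0 < v) {D : Matrix m m ℝ} (hs : Dᵀ = D)
    (hi : D * D = D) {t : ℝ} (ht0 : 0 ≤ t) (ht : 2 * t < 1) :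
    ∫⁻ x, ENNReal.ofReal (Real.exp (t / v * (x ⬝ᵥ (D *ᵥ x))))
        ∂Measure.pi (fun _ : m => gaussianReal 0 v) =
      ENNReal.ofReal ((1 - 2 * t) ^ (-(D.trace / 2))) := by
  have hv' : (0 : ℝ) < v := NNReal.coe_pos.2 hv
  have hH := isHermitian_of_transpose_eq hs
  set lam := hH.eigenvalues with hlam
  set U : Matrix m m ℝ := (hH.eigenvectorUnitary : Matrix m m ℝ) with hU
  have hUU : Uᵀ * U = 1 := eigenvectorUnitary_transpose_mul hH
  have hsq : ∀ i, lam i * lam i = lam i := by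
    intro i
    have h := hH.mulVec_eigenvectorBasis i
    have h2 : D *ᵥ (D *ᵥ (hH.eigenvectorBasis i).ofLp) = D *ᵥ (hH.eigenvectorBasis i).ofLp := by
      rw [mulVec_mulVec, hi]
    obtain ⟨j, hj⟩ : ∃ j, (hH.eigenvectorBasis i).ofLp j ≠ 0 := by
      by_contra hcon
      push Not at hcon
      have h3 := hH.eigenvectorBasis.orthonormal.ne_zero i
      exact h3 (by ext j; exact hcon j)
    rw [h, mulVec_smul, h] at h2
    have h4 := congrFun h2 j
    simp only [Pi.smul_apply, smul_eq_mul] at h4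
    rw [← mul_assoc] at h4
    exact mul_right_cancel₀ hj h4
  set V : Matrix m m ℝ := U * diagonal lam with hV
  have hVx : ∀ x : m → ℝ, (x ᵥ* V) ⬝ᵥ (x ᵥ* V) = x ⬝ᵥ (D *ᵥ x) := by
    intro x
    rw [IsHermitian.form_eq hH, ← mulVec_transpose, dotProduct]
    refine Finset.sum_congr rfl fun i _ => ?_
    rw [hV, transpose_mul, diagonal_transpose, ← mulVec_mulVec, mulVec_diagonal, mul_mul_mul_comm,
      hsq, sq]
  have hVz : ∀ z : m → ℝ, (V *ᵥ z) ⬝ᵥ (V *ᵥ z) = ∑ i, lam i * z i ^ 2 := by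
    intro z
    rw [hV, ← mulVec_mulVec, ← dotProduct_gram_mulVec, hUU, one_mulVec, dotProduct]
    refine Finset.sum_congr rfl fun i _ => ?_
    rw [mulVec_diagonal, mul_mul_mul_comm, hsq, sq]
  set s := √(2 * t / v) with hsdef
  have hss : s * s = 2 * t / v := Real.mul_self_sqrt (by positivity)
  -- Since `V Vᵀ = D`, the exponential of the quadratic form in `x` is a Gaussian average over `z`
  -- of exponentials linear in `x`. After exchanging the integrals, the one over `x` is elementary,
  -- and rotation invariance of the Gaussian law is not needed.
  have step1 : ∀ x : m → ℝ, ENNReal.ofReal (Real.exp (t / v * (x ⬝ᵥ (D *ᵥ x)))) =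
      ∫⁻ z, ENNReal.ofReal (Real.exp (s * (x ⬝ᵥ (V *ᵥ z))))
        ∂Measure.pi (fun _ : m => gaussianReal 0 1) := by
    intro x
    have h := lintegral_exp_dotProduct_gaussian 1 (s • (x ᵥ* V))
    simp only [smul_dotProduct, dotProduct_smul, smul_eq_mul, ← dotProduct_mulVec] at h
    rw [h, dotProduct_mulVec x V, hVx, NNReal.coe_one]
    congr 2
    rw [← mul_assoc s s, hss]
    ring
  have step2 : ∀ z : m → ℝ, ∫⁻ x, ENNReal.ofReal (Real.exp (s * (x ⬝ᵥ (V *ᵥ z))))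
        ∂Measure.pi (fun _ : m => gaussianReal 0 v) =
      ENNReal.ofReal (Real.exp (∑ i, t * lam i * z i ^ 2)) := by
    intro z
    have h := lintegral_exp_dotProduct_gaussian v (s • (V *ᵥ z))
    simp only [smul_dotProduct, dotProduct_smul, smul_eq_mul] at h
    simp_rw [dotProduct_comm _ (V *ᵥ z)]
    rw [h, hVz, ← mul_assoc s s, hss]
    congr 2
    rw [show ∑ i, t * lam i * z i ^ 2 = t * ∑ i, lam i * z i ^ 2 by
      rw [Finset.mul_sum]; exact Finset.sum_congr rfl fun i _ => by ring]
    field_simp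
  simp_rw [step1]
  rw [lintegral_lintegral_swap]
  · simp_rw [step2]
    have h01 : ∀ i, lam i = 0 ∨ lam i = 1 := fun i => by
      have h : lam i * (lam i - 1) = 0 := by rw [mul_sub, hsq, mul_one, sub_self]
      rcases mul_eq_zero.1 h with h | h
      · exact Or.inl h
      · exact Or.inr (sub_eq_zero.1 h)
    rw [lintegral_exp_sum_sq_gaussian (v := 1) one_pos fun i => by
      rcases h01 i with h | h <;> simp [h, ht]]
    congr 1
    have htr : D.trace = ∑ i, lam i := by
      rw [hH.trace_eq_sum_eigenvalues]; rfl
    rw [htr, Finset.sum_div, ← Finset.sum_neg_distrib, Real.rpow_sum_of_pos (by linarith)]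
    refine Finset.prod_congr rfl fun i _ => ?_
    rcases h01 i with h | h <;> simp [h]
  · have : Continuous (Function.uncurry fun x z : m → ℝ =>
        ENNReal.ofReal (Real.exp (s * (x ⬝ᵥ (V *ᵥ z))))) := by
      refine ENNReal.continuous_ofReal.comp (Real.continuous_exp.comp
        (continuous_const.mul ?_))
      exact continuous_fst.dotProduct (continuous_const.matrix_mulVec continuous_snd)
    exact this.measurable.aemeasurable

end Gaussian

/-! ### Measurability in the design. -/

section Measurability

variable {n p : ℕ}

theorem continuous_cols (γ : Finset (Fin p)) :
    Continuous fun A : Fin n → Fin p → ℝ => cols (Matrix.of A) γ :=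
  continuous_matrix fun i j => by
    change Continuous fun A : Fin n → Fin p → ℝ => A i j
    fun_prop

/-- Cramer's rule shows the entries to be rational functions of the design, hence measurable even
where the Gram matrix is singular. -/
theorem proj_eq_smul (X : Matrix (Fin n) (Fin p) ℝ) (γ : Finset (Fin p)) :
    proj X γ = ((cols X γ)ᵀ * cols X γ).det⁻¹ •
      (cols X γ * ((cols X γ)ᵀ * cols X γ).adjugate * (cols X γ)ᵀ) := by
  rw [proj, inv_def, Ring.inverse_eq_inv', Matrix.mul_smul, Matrix.smul_mul]

theorem measurable_gram_det (γ : Finset (Fin p)) :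
    Measurable fun A : Fin n → Fin p → ℝ =>
      ((cols (Matrix.of A) γ)ᵀ * cols (Matrix.of A) γ).det := by
  have h := continuous_cols (n := n) γ
  exact (h.matrix_transpose.matrix_mul h).matrix_det.measurable

theorem measurable_proj (γ : Finset (Fin p)) (i k : Fin n) :
    Measurable fun A : Fin n → Fin p → ℝ => proj (Matrix.of A) γ i k := by
  have h := continuous_cols (n := n) γ
  simp_rw [proj_eq_smul, Matrix.smul_apply, smul_eq_mul]
  refine (measurable_gram_det γ).inv.mul (Continuous.measurable ?_)
  exact ((h.matrix_mul (h.matrix_transpose.matrix_mul h).matrix_adjugate).matrix_mul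
    h.matrix_transpose).matrix_elem i k

theorem measurable_form_proj (γ : Finset (Fin p)) :
    Measurable fun z : (Fin n → Fin p → ℝ) × (Fin n → ℝ) =>
      z.2 ⬝ᵥ (proj (Matrix.of z.1) γ *ᵥ z.2) := by
  simp only [dotProduct, mulVec]
  refine Finset.measurable_sum _ fun i _ => Measurable.mul (by fun_prop) ?_
  refine Finset.measurable_sum _ fun k _ => Measurable.mul ?_ (by fun_prop)
  exact (measurable_proj γ i k).comp measurable_fst

theorem measurable_residGram (η γ : Finset (Fin p)) (i k : η) :
    Measurable fun A : Fin n → Fin p → ℝ => residGram (Matrix.of A) η γ i k := by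
  simp only [residGram, Matrix.smul_apply, mul_apply, smul_eq_mul, Matrix.sub_apply,
    transpose_apply, cols, submatrix_apply, id, of_apply]
  refine Measurable.const_mul (Finset.measurable_sum _ fun j _ => Measurable.mul ?_
    (by fun_prop)) _
  refine Finset.measurable_sum _ fun l _ => Measurable.mul (by fun_prop)
    (Measurable.const_sub (measurable_proj γ l j) _)

/-- An intersection of closed half-spaces is closed, even over uncountably many `v`. -/
theorem measurableSet_form_ge {m : Type*} [Fintype m] [Countable m] (c : ℝ) :
    MeasurableSet {M : m → m → ℝ | ∀ v : m → ℝ, c * (v ⬝ᵥ v) ≤ v ⬝ᵥ (Matrix.of M *ᵥ v)} := by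
  rw [Set.ofPred_forall]
  refine (isClosed_iInter fun v => isClosed_le continuous_const ?_).measurableSet
  exact continuous_const.dotProduct
    (Continuous.matrix_mulVec (continuous_matrix fun i j => by
      change Continuous fun A : m → m → ℝ => A i j
      fun_prop) continuous_const)

theorem measurableSet_form_le {m : Type*} [Fintype m] [Countable m] (c : ℝ) :
    MeasurableSet {M : m → m → ℝ | ∀ v : m → ℝ, v ⬝ᵥ (Matrix.of M *ᵥ v) ≤ c * (v ⬝ᵥ v)} := by
  rw [Set.ofPred_forall]
  refine (isClosed_iInter fun v => isClosed_le ?_ continuous_const).measurableSet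
  exact continuous_const.dotProduct
    (Continuous.matrix_mulVec (continuous_matrix fun i j => by
      change Continuous fun A : m → m → ℝ => A i j
      fun_prop) continuous_const)

end Measurability

/-! ### Chernoff bounds. -/

section Tails

variable {Ω : Type*} [MeasurableSpace Ω] {μ : Measure Ω} [IsProbabilityMeasure μ] {n p : ℕ}

/-- An expectation over independent `Z` and `ε` is bounded by a uniform bound for the expectation
over `ε` alone. -/
theorem lintegral_le_of_indepFun {α β : Type*} [MeasurableSpace α] [MeasurableSpace β]
    {Z : Ω → α} {ε : Ω → β} {N : Measure β} [SFinite N] (hZ : Measurable Z) (hε : HasLaw ε N μ)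
    (hind : IndepFun Z ε μ) {F : α × β → ENNReal} (hF : Measurable F) {B : ENNReal}
    (hB : ∀ z, ∫⁻ e, F (z, e) ∂N ≤ B) : ∫⁻ ω, F (Z ω, ε ω) ∂μ ≤ B := by
  have hpair : AEMeasurable (fun ω => (Z ω, ε ω)) μ := hZ.aemeasurable.prodMk hε.aemeasurable
  have h := (indepFun_iff_map_prod_eq_prod_map_map hZ.aemeasurable hε.aemeasurable).1 hind
  have : IsProbabilityMeasure (μ.map Z) := Measure.isProbabilityMeasure_map hZ.aemeasurable
  calc ∫⁻ ω, F (Z ω, ε ω) ∂μ = ∫⁻ z, F z ∂(μ.map fun ω => (Z ω, ε ω)) :=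
        (lintegral_map' hF.aemeasurable hpair).symm
    _ = ∫⁻ z, ∫⁻ e, F (z, e) ∂N ∂(μ.map Z) := by
        rw [h, hε.map_eq, lintegral_prod _ hF.aemeasurable]
    _ ≤ ∫⁻ _, B ∂(μ.map Z) := lintegral_mono hB
    _ = B := by simp

theorem measure_le_of_lintegral_exp {f : Ω → ENNReal} (hf : AEMeasurable f μ) {B r : ℝ}
    (h : ∫⁻ ω, f ω ∂μ ≤ ENNReal.ofReal B) :
    μ {ω | ENNReal.ofReal (Real.exp r) ≤ f ω} ≤ ENNReal.ofReal (Real.exp (-r) * B) := by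
  have h1 := (mul_meas_ge_le_lintegral₀ hf (ENNReal.ofReal (Real.exp r))).trans h
  calc μ {ω | ENNReal.ofReal (Real.exp r) ≤ f ω}
      = ENNReal.ofReal (Real.exp (-r)) * (ENNReal.ofReal (Real.exp r) *
        μ {ω | ENNReal.ofReal (Real.exp r) ≤ f ω}) := by
        rw [← mul_assoc, ← ENNReal.ofReal_mul (Real.exp_pos _).le, ← Real.exp_add]
        simp
    _ ≤ ENNReal.ofReal (Real.exp (-r)) * ENNReal.ofReal B := by gcongr
    _ = _ := (ENNReal.ofReal_mul (Real.exp_pos _).le).symm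

/-- Chernoff bound for the squared length of the projection of the errors onto the orthogonal
complement of the columns in `γ` within the columns in `γ'`. -/
theorem measure_form_proj_sub_ge_le {X : Ω → Matrix (Fin n) (Fin p) ℝ} {ε : Ω → Fin n → ℝ}
    {v : ℝ≥0} (hv : 0 < v) (hX : ∀ i j, Measurable fun ω => X ω i j)
    (hε : HasLaw ε (Measure.pi fun _ : Fin n => gaussianReal 0 v) μ)
    (hind : IndepFun (fun ω i j => X ω i j) ε μ) {γ γ' : Finset (Fin p)} (hs : γ ⊆ γ')
    {t : ℝ} (ht0 : 0 ≤ t) (ht : 2 * t < 1) (r : ℝ) :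
    μ {ω | (∀ b, X ω *ᵥ b = 0 → b = 0) ∧
      r ≤ ε ω ⬝ᵥ ((proj (X ω) γ' - proj (X ω) γ) *ᵥ ε ω)} ≤
      ENNReal.ofReal (Real.exp (-(t / v * r)) *
        (1 - 2 * t) ^ (-(((γ' \ γ).card : ℝ) / 2))) := by
  have hv' : (0 : ℝ) < v := NNReal.coe_pos.2 hv
  -- The indicator keeps the designs for which the trace of the projection is the number of added
  -- columns. The moment bound then holds for every fixed design, so independence carries it over to
  -- a random one.
  set F : (Fin n → Fin p → ℝ) × (Fin n → ℝ) → ENNReal :=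
    Set.indicator {z | ((cols (Matrix.of z.1) γ)ᵀ * cols (Matrix.of z.1) γ).det ≠ 0 ∧
        ((cols (Matrix.of z.1) γ')ᵀ * cols (Matrix.of z.1) γ').det ≠ 0}
      (fun z => ENNReal.ofReal (Real.exp (t / v * (z.2 ⬝ᵥ
        ((proj (Matrix.of z.1) γ' - proj (Matrix.of z.1) γ) *ᵥ z.2))))) with hF
  have hset : MeasurableSet {z : (Fin n → Fin p → ℝ) × (Fin n → ℝ) |
      ((cols (Matrix.of z.1) γ)ᵀ * cols (Matrix.of z.1) γ).det ≠ 0 ∧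
      ((cols (Matrix.of z.1) γ')ᵀ * cols (Matrix.of z.1) γ').det ≠ 0} :=
    (((measurable_gram_det γ).comp measurable_fst) (measurableSet_singleton 0).compl).inter
      (((measurable_gram_det γ').comp measurable_fst) (measurableSet_singleton 0).compl)
  have hFm : Measurable F := by
    refine Measurable.indicator ?_ hset
    simp only [sub_mulVec, dotProduct_sub]
    exact (Real.measurable_exp.comp (((measurable_form_proj γ').sub
      (measurable_form_proj γ)).const_mul _)).ennreal_ofReal
  have hXm : Measurable fun ω i j => X ω i j :=
    measurable_pi_lambda _ fun i => measurable_pi_lambda _ fun j => hX i j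
  have hB : ∀ A, ∫⁻ e, F (A, e) ∂(Measure.pi fun _ : Fin n => gaussianReal 0 v) ≤
      ENNReal.ofReal ((1 - 2 * t) ^ (-(((γ' \ γ).card : ℝ) / 2))) := by
    intro A
    by_cases hA : ((cols (Matrix.of A) γ)ᵀ * cols (Matrix.of A) γ).det ≠ 0 ∧
        ((cols (Matrix.of A) γ')ᵀ * cols (Matrix.of A) γ').det ≠ 0
    · have h1 : ∀ e, F (A, e) = ENNReal.ofReal (Real.exp (t / v * (e ⬝ᵥ
          ((proj (Matrix.of A) γ' - proj (Matrix.of A) γ) *ᵥ e)))) := fun e =>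
        Set.indicator_of_mem (s := {z : (Fin n → Fin p → ℝ) × (Fin n → ℝ) |
          ((cols (Matrix.of z.1) γ)ᵀ * cols (Matrix.of z.1) γ).det ≠ 0 ∧
          ((cols (Matrix.of z.1) γ')ᵀ * cols (Matrix.of z.1) γ').det ≠ 0}) (a := (A, e)) hA _
      simp_rw [h1]
      rw [lintegral_exp_form_gaussian hv (proj_sub_transpose _ γ γ')
        (proj_sub_idem hs hA.2.isUnit) ht0 ht, trace_sub, trace_proj hA.1.isUnit,
        trace_proj hA.2.isUnit, Finset.card_sdiff_of_subset hs,
        Nat.cast_sub (Finset.card_le_card hs)]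
    · have h1 : ∀ e, F (A, e) = 0 := fun e =>
        Set.indicator_of_notMem (s := {z : (Fin n → Fin p → ℝ) × (Fin n → ℝ) |
          ((cols (Matrix.of z.1) γ)ᵀ * cols (Matrix.of z.1) γ).det ≠ 0 ∧
          ((cols (Matrix.of z.1) γ')ᵀ * cols (Matrix.of z.1) γ').det ≠ 0}) (a := (A, e)) hA _
      simp_rw [h1]
      simp
  have hint := lintegral_le_of_indepFun hXm hε hind hFm hB
  refine le_trans (measure_mono ?_) (measure_le_of_lintegral_exp (r := t / v * r)
    (hFm.comp_aemeasurable (hXm.aemeasurable.prodMk hε.aemeasurable))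
    hint)
  rintro ω ⟨hinj, hr⟩
  change _ ≤ F (_, _)
  rw [hF, Set.indicator_of_mem]
  · exact ENNReal.ofReal_le_ofReal (Real.exp_le_exp.2
      (mul_le_mul_of_nonneg_left hr (by positivity)))
  · exact ⟨(gram_isUnit_det hinj γ).ne_zero, (gram_isUnit_det hinj γ').ne_zero⟩

theorem measure_exp_sum_sq_ge_le {ε : Ω → Fin n → ℝ} {v : ℝ≥0} (hv : 0 < v)
    (hε : HasLaw ε (Measure.pi fun _ : Fin n => gaussianReal 0 v) μ)
    {t : ℝ} (ht : 2 * t < 1) (r : ℝ) :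
    μ {ω | r ≤ t / v * (ε ω ⬝ᵥ ε ω)} ≤
      ENNReal.ofReal (Real.exp (-r) * (1 - 2 * t) ^ (-((n : ℝ) / 2))) := by
  have hv' : (0 : ℝ) < v := NNReal.coe_pos.2 hv
  have hm : Measurable fun e : Fin n → ℝ => ENNReal.ofReal (Real.exp (t / v * (e ⬝ᵥ e))) := by
    simp only [dotProduct]
    fun_prop
  have h := lintegral_exp_sum_sq_gaussian (m := Fin n) hv (d := fun _ => t / v) fun i => by
    rw [mul_assoc, div_mul_cancel₀ _ hv'.ne']; exact ht
  have hpow : ∏ _i : Fin n, (1 - 2 * (t / v) * (v : ℝ)) ^ (-(1 / 2) : ℝ) =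
      (1 - 2 * t) ^ (-((n : ℝ) / 2)) := by
    rw [Finset.prod_const, Finset.card_univ, Fintype.card_fin, ← Real.rpow_natCast,
      mul_assoc, div_mul_cancel₀ _ hv'.ne', ← Real.rpow_mul (by linarith)]
    congr 1
    ring
  rw [hpow] at h
  have hint : ∫⁻ ω, ENNReal.ofReal (Real.exp (t / v * (ε ω ⬝ᵥ ε ω))) ∂μ ≤
      ENNReal.ofReal ((1 - 2 * t) ^ (-((n : ℝ) / 2))) := by
    rw [← h, ← hε.map_eq, lintegral_map' (Measurable.aemeasurable (by fun_prop)) hε.aemeasurable]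
    refine le_of_eq (lintegral_congr fun ω => ?_)
    simp only [dotProduct, Finset.mul_sum, sq]
  refine le_trans (measure_mono fun ω hω => ?_) (measure_le_of_lintegral_exp (r := r)
    (hm.comp_aemeasurable hε.aemeasurable) hint)
  exact ENNReal.ofReal_le_ofReal (Real.exp_le_exp.2 hω)

end Tails

/-! ### The deterministic bound on a good event. -/

section PosteriorBound

variable {n p : ℕ}

/-- Removing `γ₀` is injective on its supersets, so the sum is dominated by the binomial expansion
without its empty term. -/
theorem sum_pow_card_sdiff_le {x : ℝ} (hx : 0 ≤ x) (γ₀ : Finset (Fin p)) :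
    ∑ γ ∈ (Finset.univ.erase γ₀).filter (γ₀ ⊆ ·), x ^ (γ \ γ₀).card ≤ (1 + x) ^ p - 1 := by
  have hsum : ∑ s : Finset (Fin p), x ^ s.card = (1 + x) ^ p := by
    have h := Finset.sum_pow_mul_eq_add_pow x 1 (Finset.univ : Finset (Fin p))
    simpa [add_comm] using h
  have herase : ∑ s ∈ Finset.univ.erase (∅ : Finset (Fin p)), x ^ s.card = (1 + x) ^ p - 1 := by
    rw [← hsum, ← Finset.add_sum_erase _ _ (Finset.mem_univ (∅ : Finset (Fin p)))]
    simp
  rw [← herase, ← Finset.sum_image (f := fun s : Finset (Fin p) => x ^ s.card)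
    (g := fun γ => γ \ γ₀)]
  · refine Finset.sum_le_sum_of_subset_of_nonneg ?_ fun s _ _ => pow_nonneg hx _
    intro s hs
    obtain ⟨γ, hγ, rfl⟩ := Finset.mem_image.1 hs
    obtain ⟨h1, h2⟩ := Finset.mem_filter.1 hγ
    refine Finset.mem_erase.2 ⟨fun h => Finset.ne_of_mem_erase h1 ?_, Finset.mem_univ _⟩
    exact (Finset.sdiff_eq_empty_iff_subset.1 h).antisymm h2
  · intro γ hγ γ' hγ' h
    have h1 := (Finset.mem_filter.1 hγ).2
    have h2 := (Finset.mem_filter.1 hγ').2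
    rw [← Finset.sdiff_union_of_subset h1, ← Finset.sdiff_union_of_subset h2]
    exact congrArg (· ∪ γ₀) h

/-- The two subtracted terms bound the total odds of `S₁` and `S₂`. Here `K` bounds the ridge
penalty, `L` the residual from below, `B` the gain in fit per added column, and `d` the residual gap
of a model in `S₂`. The coefficients `c` enter only through `t` and `th`, which yields uniformity.
-/
theorem one_sub_le_posterior {ν : ℝ} (hν : 0 < ν) {prior : PMF (Finset (Fin p))}
    {c : Fin p → ℝ} {t th : ℝ} (ht0 : 0 < t) (ht : ∀ j, t ≤ c j) (hth : ∀ j, c j ≤ th)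
    (htth : t ≤ th)
    {X : Matrix (Fin n) (Fin p) ℝ} (hX : ∀ v, X *ᵥ v = 0 → v = 0) {β : Fin p → ℝ}
    {e : Fin n → ℝ} {C : ℝ} (hC : 0 < C) (hpos : prior (stateOf β) ≠ 0)
    (hprior : ∀ γ, (prior γ).toReal ≤ C * (prior (stateOf β)).toReal)
    {g G h : ℝ} (hg : 0 < g) (hG : 0 < G) (hh : 0 < h)
    (hlo : ∀ v : stateOf β → ℝ,
      g * (v ⬝ᵥ v) ≤ v ⬝ᵥ (((cols X (stateOf β))ᵀ * cols X (stateOf β)) *ᵥ v))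
    (hhi : ∀ v : stateOf β → ℝ,
      v ⬝ᵥ (((cols X (stateOf β))ᵀ * cols X (stateOf β)) *ᵥ v) ≤ G * (v ⬝ᵥ v))
    (hS₁ : ∀ γ ∈ S₁ (stateOf β), ∀ v : (γ \ stateOf β : Finset (Fin p)) → ℝ,
      h * (v ⬝ᵥ v) ≤ v ⬝ᵥ (((cols X (γ \ stateOf β))ᵀ * (1 - proj X (stateOf β)) *
        cols X (γ \ stateOf β)) *ᵥ v))
    (hS₂ : ∀ γ ∈ S₂ (stateOf β), ∀ v : (stateOf β \ γ : Finset (Fin p)) → ℝ,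
      g * (v ⬝ᵥ v) ≤ v ⬝ᵥ (((cols X (stateOf β \ γ))ᵀ * (1 - proj X γ) *
        cols X (stateOf β \ γ)) *ᵥ v))
    {m : ℝ} (hm : 0 ≤ m) (hβ : ∀ j ∈ stateOf β, m ≤ |β j|)
    {K L B Λ d : ℝ} (hK0 : 0 ≤ K) (hL : 0 < L) (hB0 : 0 ≤ B) (hd : 0 < d)
    (hK : (2 * ∑ j ∈ stateOf β, β j ^ 2 + 2 * (e ⬝ᵥ e / g)) / t ≤ K)
    (hLQ : L ≤ e ⬝ᵥ e - e ⬝ᵥ (proj X Finset.univ *ᵥ e))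
    (hB : ∀ γ ∈ S₁ (stateOf β), e ⬝ᵥ ((proj X γ - proj X (stateOf β)) *ᵥ e) ≤
      (γ \ stateOf β).card * B)
    (hΛ : 1 + e ⬝ᵥ e + K ≤ Λ)
    (hdQ : d ≤ g * m ^ 2 / 2 - 3 * (e ⬝ᵥ (proj X Finset.univ *ᵥ e)) - K) :
    1 - (C * Real.exp ((n + ν) / 2 * (K / L)) *
        ((1 + Real.exp ((n + ν) / 2 * (B / L)) * (h * t) ^ (-(1 / 2) : ℝ)) ^ p - 1) +
      2 ^ p * (C * ((1 + G * th) ^ p) ^ (1 / 2 : ℝ) * (Λ / (Λ + d)) ^ ((n + ν) / 2))) ≤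
      posterior ν prior c X (X *ᵥ β + e) (stateOf β) := by
  have hc : ∀ j, 0 < c j := fun j => ht0.trans_le (ht j)
  set γ₀ := stateOf β with hγ₀
  set y := X *ᵥ β + e with hy
  have hEnn := dotProduct_self_nonneg' e
  have hth0 : 0 < th := ht0.trans_le htth
  have hR0 : ridgeRss c X y γ₀ ≤ e ⬝ᵥ ((1 - proj X γ₀) *ᵥ e) + K :=
    (ridgeRss_true_le hc ht0 ht hg hlo e).trans (add_le_add le_rfl hK)
  have hR0' : ridgeRss c X y γ₀ ≤ e ⬝ᵥ e + K :=
    hR0.trans (add_le_add (form_idem_le (one_sub_symm (proj_transpose X γ₀))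
      (one_sub_idem (proj_mul_self X γ₀)) e) le_rfl)
  have hR0nn := ridgeRss_nonneg hc X y γ₀
  have hΛ0 : 0 < Λ := by linarith
  set D := Real.exp ((n + ν) / 2 * (K / L)) with hD
  set x := Real.exp ((n + ν) / 2 * (B / L)) * (h * t) ^ (-(1 / 2) : ℝ) with hx
  have hx0 : 0 ≤ x := by positivity
  set r2 := C * ((1 + G * th) ^ p) ^ (1 / 2 : ℝ) * (Λ / (Λ + d)) ^ ((n + ν) / 2) with hr2
  have hr20 : 0 ≤ r2 := by positivity
  refine le_posterior hc hpos
    (r := fun γ => if γ₀ ⊆ γ then C * D * x ^ (γ \ γ₀).card else r2) ?_ ?_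
  · intro γ hγ
    by_cases hsub : γ₀ ⊆ γ
    · rw [if_pos hsub]
      set k := (γ \ γ₀).card
      have hmem : γ ∈ S₁ γ₀ := ⟨hsub, hγ⟩
      have hR := le_ridgeRss_of_subset hc hsub (gram_isUnit_det hX γ) e
      rw [← hy] at hR
      have hmono := form_proj_mono (Finset.subset_univ γ) (gram_isUnit_det hX Finset.univ) e
      have hBγ := hB γ hmem
      rw [sub_mulVec, one_mulVec, dotProduct_sub] at hR hR0
      rw [sub_mulVec, dotProduct_sub] at hBγ
      have hRL : L ≤ ridgeRss c X y γ := by linarith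
      -- `R γ₀ ≤ R γ + K + k B` and `R γ ≥ L` bound the ratio by `1 + (K + k B) / L`, hence by the
      -- exponential.
      have hρ : 1 + ridgeRss c X y γ₀ ≤
          Real.exp ((K + k * B) / L) * (1 + ridgeRss c X y γ) := by
        have h1 := Real.add_one_le_exp ((K + k * B) / L)
        have h2 : 0 ≤ (K + k * B) / L := by positivity
        have h3 : K + k * B ≤ (K + k * B) / L * (1 + ridgeRss c X y γ) := by
          rw [div_mul_eq_mul_div, le_div_iff₀ hL]
          exact mul_le_mul_of_nonneg_left (by linarith) (by positivity)
        have h4 := mul_le_mul_of_nonneg_right h1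
          (by linarith : 0 ≤ 1 + ridgeRss c X y γ)
        linarith
      have hw := postWeight_le_mul hν hc (d := (h * t) ^ k) (by positivity)
        (Real.exp_pos _).le (hprior γ)
        (det_wMat_mul_le hc ht0.le ht hh.le hsub (gram_isUnit_det hX γ₀) (hS₁ γ hmem)) hρ
      refine hw.trans (le_of_eq ?_)
      congr 1
      have e1 : ((h * t) ^ k) ^ (-(1 / 2) : ℝ) = ((h * t) ^ (-(1 / 2) : ℝ)) ^ k := by
        rw [← Real.rpow_natCast, ← Real.rpow_natCast, ← Real.rpow_mul (by positivity),
          ← Real.rpow_mul (by positivity), mul_comm (k : ℝ)]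
      rw [e1, hx, mul_pow, hD, ← Real.exp_nat_mul, ← Real.exp_mul,
        show (K + k * B) / L * ((n + ν) / 2) =
          (n + ν) / 2 * (K / L) + k * ((n + ν) / 2 * (B / L)) by ring, Real.exp_add]
      ring
    · rw [if_neg hsub]
      have hR := le_ridgeRss_of_not_subset hc hX hsub hg.le hm hβ (hS₂ γ hsub) e
      rw [← hy] at hR
      -- `s / (s + d)` increases in `s`, and `1 + R γ₀ ≤ Λ`.
      have hρ : 1 + ridgeRss c X y γ₀ ≤ Λ / (Λ + d) * (1 + ridgeRss c X y γ) := by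
        rw [div_mul_eq_mul_div, le_div_iff₀ (by positivity)]
        have h1 : ridgeRss c X y γ₀ + d ≤ ridgeRss c X y γ := by linarith
        have h2 := mul_le_mul_of_nonneg_left h1 hΛ0.le
        have h3 : 1 + ridgeRss c X y γ₀ ≤ Λ := by linarith
        nlinarith [mul_le_mul_of_nonneg_right h3 hd.le]
      have hb1 : 1 ≤ 1 + G * th := by nlinarith
      have hdet : (wMat c X γ₀).det * ((1 + G * th) ^ p)⁻¹ ≤ (wMat c X γ).det := by
        refine le_trans ?_ (one_le_det_wMat hc X γ)
        rw [← div_eq_mul_inv]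
        refine div_le_one_of_le₀ ?_ (by positivity)
        exact (det_wMat_le hc hth hG.le hhi).trans
          (pow_le_pow_right₀ hb1 ((Finset.card_le_univ γ₀).trans_eq (Fintype.card_fin p)))
      have hw := postWeight_le_mul hν hc (d := ((1 + G * th) ^ p)⁻¹) (by positivity)
        (by positivity) (hprior γ) hdet hρ
      rwa [Real.inv_rpow (by positivity), Real.rpow_neg (by positivity), inv_inv] at hw
  · rw [Finset.sum_ite, ← Finset.mul_sum]
    refine add_le_add (mul_le_mul_of_nonneg_left (sum_pow_card_sdiff_le hx0 γ₀)
      (by positivity)) ?_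
    rw [Finset.sum_const, nsmul_eq_mul]
    refine mul_le_mul_of_nonneg_right ?_ hr20
    have h1 := Finset.card_le_univ ({γ ∈ Finset.univ.erase γ₀ | ¬γ₀ ⊆ γ})
    rw [Fintype.card_finset, Fintype.card_fin] at h1
    exact_mod_cast h1

end PosteriorBound

/-! ### Limits of the two error terms. -/

section Asymptotics

theorem one_add_pow_sub_one_le {x : ℝ} (hx : 0 ≤ x) (p : ℕ) :
    (1 + x) ^ p - 1 ≤ Real.exp (p * x) - 1 := by
  rw [Real.exp_nat_mul]
  have h : 1 + x ≤ Real.exp x := by linarith [Real.add_one_le_exp x]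
  linarith [pow_le_pow_left₀ (by linarith) h p]

theorem tendsto_one_add_pow_sub_one {p : ℕ → ℕ} {x : ℕ → ℝ} (hx0 : ∀ᶠ n in atTop, 0 ≤ x n)
    (hp : ∀ᶠ n in atTop, p n ≤ n) {c η : ℝ} (hη : 0 < η)
    (hx : ∀ᶠ n : ℕ in atTop, x n ≤ c * (n : ℝ) ^ (-(1 + η))) :
    Tendsto (fun n => (1 + x n) ^ p n - 1) atTop (𝓝 0) := by
  have h1 : Tendsto (fun n : ℕ => c * (n : ℝ) ^ (-η)) atTop (𝓝 0) := by
    have := ((tendsto_rpow_neg_atTop hη).comp tendsto_natCast_atTop_atTop).const_mul c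
    rwa [mul_zero] at this
  have h2 : Tendsto (fun n : ℕ => Real.exp (c * (n : ℝ) ^ (-η)) - 1) atTop (𝓝 0) := by
    have := (Real.continuous_exp.tendsto 0).comp h1
    rw [Real.exp_zero] at this
    simpa using this.sub_const 1
  refine squeeze_zero' ?_ ?_ h2
  · filter_upwards [hx0] with n h
    linarith [one_le_pow₀ (M₀ := ℝ) (n := p n) (by linarith : 1 ≤ 1 + x n)]
  · filter_upwards [hx0, hp, hx, eventually_ge_atTop 1] with n h0 hpn hxn hn
    refine (one_add_pow_sub_one_le h0 _).trans (sub_le_sub_right (Real.exp_le_exp.2 ?_) _)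
    have hn0 : (0 : ℝ) < n := by exact_mod_cast hn
    calc (p n : ℝ) * x n ≤ n * x n := mul_le_mul_of_nonneg_right (by exact_mod_cast hpn) h0
      _ ≤ n * (c * (n : ℝ) ^ (-(1 + η))) := mul_le_mul_of_nonneg_left hxn hn0.le
      _ = c * (n : ℝ) ^ (-η) := by
        rw [neg_add, Real.rpow_add hn0, Real.rpow_neg_one]
        field_simp

theorem eventually_mul_log_le {p : ℕ → ℕ}
    (hp : (fun n : ℕ => (p n : ℝ) * Real.log n) =o[atTop] fun n : ℕ => (n : ℝ)) {l : ℝ}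
    (hl : 0 < l) : ∀ᶠ n : ℕ in atTop, (p n : ℝ) * Real.log n ≤ l * n := by
  filter_upwards [hp.def hl] with n h
  rw [Real.norm_eq_abs, Real.norm_eq_abs, Nat.abs_cast] at h
  exact (le_abs_self _).trans h

theorem eventually_one_le_log : ∀ᶠ n : ℕ in atTop, 1 ≤ Real.log n :=
  (Real.tendsto_log_atTop.comp tendsto_natCast_atTop_atTop).eventually_ge_atTop 1

theorem eventually_dim_le_mul {p : ℕ → ℕ}
    (hp : (fun n : ℕ => (p n : ℝ) * Real.log n) =o[atTop] fun n : ℕ => (n : ℝ)) {l : ℝ}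
    (hl : 0 < l) : ∀ᶠ n : ℕ in atTop, (p n : ℝ) ≤ l * n := by
  filter_upwards [eventually_mul_log_le hp hl, eventually_one_le_log] with n h1 h2
  nlinarith [(Nat.cast_nonneg (p n) : (0 : ℝ) ≤ p n)]

theorem tendsto_exp_neg_mul_nat {l : ℝ} (hl : 0 < l) :
    Tendsto (fun n : ℕ => Real.exp (-(l * n))) atTop (𝓝 0) :=
  Real.tendsto_exp_neg_atTop_nhds_zero.comp
    (tendsto_natCast_atTop_atTop.const_mul_atTop hl)

/-- The total weight of the models strictly containing the true one vanishes. -/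
theorem tendsto_overfit_bound {p : ℕ → ℕ}
    (hp : (fun n : ℕ => (p n : ℝ) * Real.log n) =o[atTop] fun n : ℕ => (n : ℝ))
    {ν v a κ K C C₃ δ δ₀ : ℝ} (hν : 0 < ν) (hv : 0 < v) (ha : 0 < a) (ha4 : a ≤ 1 / 4)
    (haκ : a ≤ κ / 20) (hC₃ : 0 < C₃) (hκ : δ₀ = 3 + δ + κ)
    {φlo : ℕ → ℝ} (hφloO : (fun n : ℕ => (n : ℝ) ^ δ₀) =O[atTop] φlo)
    (hφlo : ∀ n, 1 ≤ n → 0 < φlo n) :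
    Tendsto (fun n : ℕ => C * Real.exp ((n + ν) / 2 * (K / ((1 - a) * v * n))) *
      ((1 + Real.exp ((n + ν) / 2 * (2 * v * (1 + a) * Real.log n / ((1 - a) * v * n))) *
        (n * (C₃ * (n : ℝ) ^ (-δ)) * φlo n) ^ (-(1 / 2) : ℝ)) ^ p n - 1)) atTop (𝓝 0) := by
  have hκ0 : 0 < κ := by linarith
  have h1a : 0 < 1 - a := by linarith
  have hratio : Tendsto (fun n : ℕ => ((n : ℝ) + ν) / 2 * (K / ((1 - a) * v * n))) atTop
      (𝓝 (K / (2 * ((1 - a) * v)))) := by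
    have h1 : Tendsto (fun n : ℕ => K / (2 * ((1 - a) * v)) * (1 + ν / n)) atTop
        (𝓝 (K / (2 * ((1 - a) * v)) * (1 + 0))) :=
      ((tendsto_const_div_atTop_nhds_zero_nat ν).const_add 1).const_mul _
    rw [add_zero, mul_one] at h1
    refine h1.congr' ?_
    filter_upwards [eventually_ge_atTop 1] with n hn
    have hn0 : (0 : ℝ) < n := by exact_mod_cast hn
    field_simp
  have hfirst := ((Real.continuous_exp.tendsto _).comp hratio).const_mul C
  obtain ⟨M, hM, hMφ⟩ := hφloO.exists_pos
  have hsecond := tendsto_one_add_pow_sub_one (p := p)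
    (x := fun n : ℕ => Real.exp ((n + ν) / 2 *
      (2 * v * (1 + a) * Real.log n / ((1 - a) * v * n))) *
        (n * (C₃ * (n : ℝ) ^ (-δ)) * φlo n) ^ (-(1 / 2) : ℝ))
    (c := (C₃ / M) ^ (-(1 / 2) : ℝ)) (η := κ / 4)
    (by
      filter_upwards [eventually_ge_atTop 1] with n hn
      have := hφlo n hn
      positivity)
    (by
      filter_upwards [eventually_dim_le_mul hp one_pos] with n h
      rw [one_mul] at h
      exact_mod_cast h)
    (by linarith)
    (by
      filter_upwards [hMφ.bound, eventually_ge_atTop 1, eventually_ge_atTop ⌈ν / a⌉₊] with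
        n hφ hn hna
      have hn1 : (1 : ℝ) ≤ n := by exact_mod_cast hn
      have hn0 : (0 : ℝ) < n := by linarith
      have hlog : 0 ≤ Real.log n := Real.log_nonneg hn1
      have hνn : ν ≤ a * n := by
        have := (Nat.ceil_le.1 hna)
        rwa [div_le_iff₀ ha, mul_comm] at this
      have hφ' : (n : ℝ) ^ δ₀ ≤ M * φlo n := by
        rwa [Real.norm_of_nonneg (Real.rpow_nonneg hn0.le _),
          Real.norm_of_nonneg (hφlo n hn).le] at hφ
      -- Once `ν ≤ a n`, the exponent of `n` is at most `(1+a)²/(1-a)`; the choice of `a` keeps this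
      -- below `1 + κ/4`.
      have e1 : Real.exp ((n + ν) / 2 * (2 * v * (1 + a) * Real.log n / ((1 - a) * v * n))) ≤
          (n : ℝ) ^ (1 + κ / 4) := by
        rw [Real.rpow_def_of_pos hn0, Real.exp_le_exp]
        have : (n + ν) / 2 * (2 * v * (1 + a) * Real.log n / ((1 - a) * v * n)) =
            Real.log n * ((n + ν) * (1 + a) / ((1 - a) * n)) := by
          field_simp
        rw [this]
        refine mul_le_mul_of_nonneg_left ?_ hlog
        rw [div_le_iff₀ (by positivity)]
        have h2 : (n + ν) * (1 + a) ≤ n * ((1 + a) * (1 + a)) := by nlinarith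
        have h3 : (1 + a) * (1 + a) ≤ (1 + κ / 4) * (1 - a) := by nlinarith
        nlinarith
      -- The base is of order at least `n^(1-δ+δ₀) = n^(4+κ)`. Its inverse square root times `e1`
      -- gives `n^(-(1+κ/4))`, small even after multiplication by `p ≤ n`; this is where `δ₀ > 3 +
      -- δ` is needed.
      have e2 : (n * (C₃ * (n : ℝ) ^ (-δ)) * φlo n) ^ (-(1 / 2) : ℝ) ≤
          (C₃ / M) ^ (-(1 / 2) : ℝ) * (n : ℝ) ^ (-(2 + κ / 2)) := by
        have h4 : (n : ℝ) ^ (-(2 + κ / 2)) = ((n : ℝ) ^ (4 + κ)) ^ (-(1 / 2) : ℝ) := by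
          rw [← Real.rpow_mul hn0.le]
          congr 1
          ring
        rw [h4, ← Real.mul_rpow (by positivity) (by positivity)]
        refine Real.rpow_le_rpow_of_nonpos (by positivity) ?_ (by norm_num)
        have h5 : (n : ℝ) ^ (4 + κ) = n * (n : ℝ) ^ (-δ) * (n : ℝ) ^ δ₀ := by
          rw [show 4 + κ = 1 + -δ + δ₀ by linarith, Real.rpow_add hn0, Real.rpow_add hn0,
            Real.rpow_one]
        rw [h5]
        calc C₃ / M * (n * (n : ℝ) ^ (-δ) * (n : ℝ) ^ δ₀)
            ≤ C₃ / M * (n * (n : ℝ) ^ (-δ) * (M * φlo n)) := by gcongr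
          _ = _ := by field_simp
      calc _ ≤ (n : ℝ) ^ (1 + κ / 4) *
            ((C₃ / M) ^ (-(1 / 2) : ℝ) * (n : ℝ) ^ (-(2 + κ / 2))) := by
            have := hφlo n hn
            gcongr
        _ = (C₃ / M) ^ (-(1 / 2) : ℝ) * ((n : ℝ) ^ (1 + κ / 4) * (n : ℝ) ^ (-(2 + κ / 2))) := by
            ring
        _ = _ := by
            rw [← Real.rpow_add hn0]
            congr 2
            ring)
  have h := hfirst.mul hsecond
  rw [mul_zero] at h
  exact h

/-- The total weight of the models missing a true coefficient vanishes. -/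
theorem tendsto_underfit_bound {p : ℕ → ℕ}
    (hp : (fun n : ℕ => (p n : ℝ) * Real.log n) =o[atTop] fun n : ℕ => (n : ℝ))
    {ν C C₂ Λ d δ₀ : ℝ} (hν : 0 < ν) (hC : 0 < C) (hC₂ : 0 < C₂) (hΛ : 0 < Λ) (hd : 0 < d)
    (hδ₀ : 0 ≤ δ₀) {φhi : ℕ → ℝ} (hφhiO : φhi =O[atTop] fun n : ℕ => (n : ℝ) ^ δ₀)
    (hφhi : ∀ n, 1 ≤ n → 0 < φhi n) :
    Tendsto (fun n : ℕ => 2 ^ p n * (C * ((1 + n * C₂ * φhi n) ^ p n) ^ (1 / 2 : ℝ) *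
      (Λ * n / (Λ * n + d * n)) ^ ((n + ν) / 2))) atTop (𝓝 0) := by
  -- The residual ratio decays like `exp(-l n / 2)`. Half of this rate absorbs the number of models
  -- and the determinant.
  set l := Real.log (1 + d / Λ) with hl
  have hl0 : 0 < l := Real.log_pos (by linarith [div_pos hd hΛ])
  obtain ⟨M, hM, hMφ⟩ := hφhiO.exists_pos
  have hA : 0 < 1 + (δ₀ + 2) / 2 := by linarith
  have hlim := (tendsto_exp_neg_mul_nat (l := l / 4) (by linarith)).const_mul C
  rw [mul_zero] at hlim
  refine squeeze_zero' ?_ ?_ hlim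
  · filter_upwards [eventually_ge_atTop 1] with n hn
    have := hφhi n hn
    positivity
  · filter_upwards [hMφ.bound, eventually_ge_atTop 1, eventually_one_le_log,
      eventually_ge_atTop ⌈1 + C₂ * M⌉₊,
      eventually_mul_log_le hp (l := l / 4 / (1 + (δ₀ + 2) / 2)) (by positivity)] with
      n hφ hn hlog hnM hpl
    have hφ0 := hφhi n hn
    have hn1 : (1 : ℝ) ≤ n := by exact_mod_cast hn
    have hn0 : (0 : ℝ) < n := by linarith
    have hnM' : 1 + C₂ * M ≤ n := Nat.ceil_le.1 hnM
    have hφ' : φhi n ≤ M * (n : ℝ) ^ δ₀ := by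
      rwa [Real.norm_of_nonneg (Real.rpow_nonneg hn0.le _), Real.norm_of_nonneg hφ0.le] at hφ
    have hbase : 1 + n * C₂ * φhi n ≤ (n : ℝ) ^ (δ₀ + 2) := by
      have h1 : (n : ℝ) ^ (δ₀ + 2) = n * (n * (n : ℝ) ^ δ₀) := by
        rw [Real.rpow_add hn0, Real.rpow_two]; ring
      have h2 : 1 ≤ n * (n : ℝ) ^ δ₀ := by
        nlinarith [Real.one_le_rpow hn1 hδ₀]
      have h3 : n * C₂ * φhi n ≤ C₂ * M * (n * (n : ℝ) ^ δ₀) := by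
        calc n * C₂ * φhi n ≤ n * C₂ * (M * (n : ℝ) ^ δ₀) := by gcongr
          _ = _ := by ring
      rw [h1]
      nlinarith
    have hpn : (0 : ℝ) ≤ p n := Nat.cast_nonneg _
    have e0 : (2 : ℝ) ^ p n ≤ Real.exp (p n * Real.log n) := by
      rw [Real.exp_nat_mul]
      refine pow_le_pow_left₀ (by norm_num) ?_ _
      linarith [Real.add_one_le_exp (Real.log n)]
    have e1 : ((1 + n * C₂ * φhi n) ^ p n) ^ (1 / 2 : ℝ) ≤
        Real.exp (p n * Real.log n * ((δ₀ + 2) / 2)) := by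
      calc ((1 + n * C₂ * φhi n) ^ p n) ^ (1 / 2 : ℝ) ≤
          (((n : ℝ) ^ (δ₀ + 2)) ^ p n) ^ (1 / 2 : ℝ) := by gcongr
        _ = _ := by
          rw [← Real.rpow_natCast, ← Real.rpow_mul (by positivity), ← Real.rpow_mul hn0.le,
            Real.rpow_def_of_pos hn0]
          congr 1
          ring
    have e2 : (Λ * n / (Λ * n + d * n)) ^ ((n + ν) / 2) ≤ Real.exp (-(l / 2 * n)) := by
      have h1 : Λ * n / (Λ * n + d * n) = (1 + d / Λ)⁻¹ := by field_simp
      rw [h1, Real.rpow_def_of_pos (by positivity), Real.log_inv, ← hl, Real.exp_le_exp]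
      nlinarith
    have hexp : p n * Real.log n + p n * Real.log n * ((δ₀ + 2) / 2) + -(l / 2 * n) ≤
        -(l / 4 * n) := by
      have h1 := mul_le_mul_of_nonneg_right hpl hA.le
      have h2 : l / 4 / (1 + (δ₀ + 2) / 2) * n * (1 + (δ₀ + 2) / 2) = l / 4 * n := by
        field_simp
      rw [h2] at h1
      linarith
    calc _ ≤ Real.exp (p n * Real.log n) * (C * Real.exp (p n * Real.log n * ((δ₀ + 2) / 2)) *
          Real.exp (-(l / 2 * n))) := by gcongr
      _ = C * Real.exp (p n * Real.log n + p n * Real.log n * ((δ₀ + 2) / 2) +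
          -(l / 2 * n)) := by
          rw [Real.exp_add, Real.exp_add]; ring
      _ ≤ _ := by gcongr

end Asymptotics

/-! ### Eigenvalue conditions as quadratic-form inequalities. -/

section Design

variable {n p : ℕ}

theorem form_residGram (X : Matrix (Fin n) (Fin p) ℝ) (η γ : Finset (Fin p)) (v : η → ℝ) :
    v ⬝ᵥ (residGram X η γ *ᵥ v) =
      1 / (n : ℝ) * (v ⬝ᵥ (((cols X η)ᵀ * (1 - proj X γ) * cols X η) *ᵥ v)) := by
  rw [residGram, smul_mulVec, dotProduct_smul, smul_eq_mul]

theorem proj_empty (X : Matrix (Fin n) (Fin p) ℝ) : proj X ∅ = 0 := by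
  ext i k
  simp [proj, mul_apply]

/-- A design is regular if the eigenvalue conditions on `φ_min` and `φ_max` hold in the form of
inequalities between quadratic forms. -/
def RegularDesign (γ₀ : Finset (Fin p)) (c C : ℝ) (X : Matrix (Fin n) (Fin p) ℝ) : Prop :=
  (∀ γ : Finset (Fin p), ¬ γ₀ ⊆ γ → ∀ v : (γ₀ \ γ : Finset (Fin p)) → ℝ,
    c * (v ⬝ᵥ v) ≤ v ⬝ᵥ (residGram X (γ₀ \ γ) γ *ᵥ v)) ∧
  ∀ v : γ₀ → ℝ, v ⬝ᵥ (residGram X γ₀ ∅ *ᵥ v) ≤ C * (v ⬝ᵥ v)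

theorem measurableSet_regularDesign (γ₀ : Finset (Fin p)) (c C : ℝ) :
    MeasurableSet {A : Fin n → Fin p → ℝ | RegularDesign γ₀ c C (Matrix.of A)} := by
  have hm : ∀ η γ : Finset (Fin p), Measurable fun A : Fin n → Fin p → ℝ =>
      (fun i k => residGram (Matrix.of A) η γ i k : η → η → ℝ) := fun η γ =>
    measurable_pi_lambda _ fun i => measurable_pi_lambda _ fun k => measurable_residGram η γ i k
  refine MeasurableSet.inter ?_ (hm γ₀ ∅ (measurableSet_form_le C))
  change MeasurableSet {A : Fin n → Fin p → ℝ | ∀ γ : Finset (Fin p), ¬ γ₀ ⊆ γ →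
    ∀ v : (γ₀ \ γ : Finset (Fin p)) → ℝ,
      c * (v ⬝ᵥ v) ≤ v ⬝ᵥ (residGram (Matrix.of A) (γ₀ \ γ) γ *ᵥ v)}
  rw [Set.ofPred_forall]
  refine MeasurableSet.iInter fun γ => ?_
  rw [Set.ofPred_forall]
  exact MeasurableSet.iInter fun _ => hm (γ₀ \ γ) γ (measurableSet_form_ge c)

theorem residGram_empty (X : Matrix (Fin n) (Fin p) ℝ) (η : Finset (Fin p)) :
    residGram X η ∅ = (1 / (n : ℝ)) • ((cols X η)ᵀ * cols X η) := by
  rw [residGram, proj_empty, sub_zero, Matrix.mul_one]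

theorem regularDesign_of_phi {γ₀ : Finset (Fin p)} (h₀ : γ₀.Nonempty) {c C : ℝ}
    {X : Matrix (Fin n) (Fin p) ℝ} (hc : c ≤ phiMin γ₀ X) (hC : phiMax γ₀ X ≤ C) :
    RegularDesign γ₀ c C X := by
  refine ⟨fun γ hγ => form_ge_of_le_eigMin (residGram_transpose X _ _) (hc.trans ?_), ?_⟩
  · exact ciInf_le (Set.finite_range fun γ : S₂ γ₀ =>
      eigMin (residGram X (γ₀ \ (γ : Finset (Fin p))) γ)).bddBelow ⟨γ, hγ⟩
  -- As `γ₀` is nonempty, the empty model is in `S₂`, and its term in `phiMax` concerns the full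
  -- Gram matrix of `γ₀`.
  · have h1 : ¬ γ₀ ⊆ ∅ := fun h => h₀.ne_empty (Finset.subset_empty.1 h)
    have h2 := (le_ciSup (Set.finite_range fun γ : S₂ γ₀ => eigMax ((1 / (n : ℝ)) •
      ((cols X (γ₀ \ (γ : Finset (Fin p))))ᵀ * cols X (γ₀ \ (γ : Finset (Fin p)))))).bddAbove
      ⟨∅, h1⟩).trans hC
    have h3 := fun v => form_le_of_eigMax_le (by
      rw [transpose_smul, gram_transpose]) h2 v
    simp only at h3
    rw [Finset.sdiff_empty] at h3
    rw [residGram_empty]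
    exact h3

end Design

/-! ### Exceptional events of vanishing probability. -/

section Events

variable {Ω : Type*} [MeasurableSpace Ω] {μ : Measure Ω} [IsProbabilityMeasure μ]

theorem tendsto_measure_compl_of_ae_eventually {A : ℕ → Set Ω} (hA : ∀ n, MeasurableSet (A n))
    (h : ∀ᵐ ω ∂μ, ∀ᶠ n in atTop, ω ∈ A n) :
    Tendsto (fun n => μ (A n)ᶜ) atTop (𝓝 0) := by
  have := tendsto_measure_of_ae_tendsto_indicator (μ := μ) atTop (A := ∅)
    MeasurableSet.empty (fun n => (hA n).compl) (B := Set.univ) MeasurableSet.univ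
    (measure_ne_top _ _) (Eventually.of_forall fun _ => Set.subset_univ _) (by
      filter_upwards [h] with ω hω
      filter_upwards [hω] with n hn
      simp [hn])
  simpa using this

theorem tendsto_measure_of_le_ofReal {s : ℕ → Set Ω} {b : ℕ → ℝ}
    (h : ∀ᶠ n in atTop, μ (s n) ≤ ENNReal.ofReal (b n)) (hb : Tendsto b atTop (𝓝 0)) :
    Tendsto (fun n => μ (s n)) atTop (𝓝 0) := by
  have h1 : Tendsto (fun n => ENNReal.ofReal (b n)) atTop (𝓝 0) := by
    simpa using ENNReal.tendsto_ofReal hb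
  exact tendsto_of_tendsto_of_tendsto_of_le_of_le' tendsto_const_nhds h1
    (Eventually.of_forall fun _ => zero_le) h

variable {ε : ∀ n : ℕ, Ω → Fin n → ℝ} {v : ℝ≥0}

theorem tendsto_measure_sum_sq_gt (hv : 0 < v)
    (hε : ∀ n, 1 ≤ n → HasLaw (ε n) (Measure.pi fun _ : Fin n => gaussianReal 0 v) μ) :
    Tendsto (fun n : ℕ => μ {ω | 2 * v * n < ε n ω ⬝ᵥ ε n ω}) atTop (𝓝 0) := by
  have hv' : (0 : ℝ) < v := NNReal.coe_pos.2 hv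
  have hlog := Real.log_two_lt_d9
  refine tendsto_measure_of_le_ofReal (b := fun n : ℕ => Real.exp (-((1 - Real.log 2) / 2 * n)))
    ?_ (tendsto_exp_neg_mul_nat (by linarith))
  filter_upwards [eventually_ge_atTop 1] with n hn
  refine (measure_mono fun ω hω => ?_).trans ((measure_exp_sum_sq_ge_le hv (hε n hn)
    (t := 1 / 4) (by norm_num) (n / 2)).trans (ENNReal.ofReal_le_ofReal (le_of_eq ?_)))
  · change (n : ℝ) / 2 ≤ 1 / 4 / v * _
    have hω' : 2 * v * n < ε n ω ⬝ᵥ ε n ω := hω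
    rw [div_mul_eq_mul_div, le_div_iff₀ hv']
    linarith
  · rw [show (1 - 2 * (1 / 4) : ℝ) = 2⁻¹ by norm_num, Real.rpow_def_of_pos (by norm_num),
      Real.log_inv, ← Real.exp_add]
    congr 1
    ring

theorem tendsto_measure_sum_sq_lt (hv : 0 < v)
    (hε : ∀ n, 1 ≤ n → HasLaw (ε n) (Measure.pi fun _ : Fin n => gaussianReal 0 v) μ)
    {s : ℝ} (hs : 0 < s) :
    Tendsto (fun n : ℕ => μ {ω | ε n ω ⬝ᵥ ε n ω < (1 - s) * v * n}) atTop (𝓝 0) := by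
  have hv' : (0 : ℝ) < v := NNReal.coe_pos.2 hv
  have hl : 0 < s ^ 3 / (1 + s) := by positivity
  refine tendsto_measure_of_le_ofReal (b := fun n : ℕ => Real.exp (-(s ^ 3 / (1 + s) * n)))
    ?_ (tendsto_exp_neg_mul_nat hl)
  filter_upwards [eventually_ge_atTop 1] with n hn
  refine (measure_mono fun ω hω => ?_).trans ((measure_exp_sum_sq_ge_le hv (hε n hn)
    (t := -s) (by linarith) (-(s * (1 - s) * n))).trans (ENNReal.ofReal_le_ofReal ?_))
  · change -(s * (1 - s) * n) ≤ -s / v * _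
    have hω' : ε n ω ⬝ᵥ ε n ω < (1 - s) * v * n := hω
    rw [div_mul_eq_mul_div, le_div_iff₀ hv']
    nlinarith
  · rw [Real.rpow_def_of_pos (by linarith), ← Real.exp_add, Real.exp_le_exp]
    -- `log (1 + 2s) ≥ 2s/(1+s)` makes the exponent per observation at most `s(1-s) - s/(1+s) =
    -- -s³/(1+s)`.
    have h1 := Real.le_log_one_add_of_nonneg (x := 2 * s) (by linarith)
    have h2 : 2 * (2 * s) / (2 * s + 2) = 2 * (s / (1 + s)) := by field_simp; ring
    rw [h2] at h1
    rw [show 1 - 2 * -s = 1 + 2 * s by ring]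
    have h3 : s ^ 3 / (1 + s) + s * (1 - s) - s / (1 + s) = 0 := by field_simp; ring
    have hn0 : (0 : ℝ) ≤ n := Nat.cast_nonneg n
    nlinarith [mul_le_mul_of_nonneg_left h1 hn0]

variable {p : ℕ → ℕ} {X : ∀ n, Ω → Matrix (Fin n) (Fin (p n)) ℝ}

/-- The projected noise has only `p = o(n)` degrees of freedom. -/
theorem tendsto_measure_proj_ge (hv : 0 < v)
    (hX : ∀ n, 1 ≤ n → ∀ i j, Measurable fun ω => X n ω i j)
    (hε : ∀ n, 1 ≤ n → HasLaw (ε n) (Measure.pi fun _ : Fin n => gaussianReal 0 v) μ)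
    (hind : ∀ n, 1 ≤ n → IndepFun (fun ω i j => X n ω i j) (ε n) μ)
    (hp : (fun n : ℕ => (p n : ℝ) * Real.log n) =o[atTop] fun n : ℕ => (n : ℝ))
    {b : ℝ} (hb : 0 < b) :
    Tendsto (fun n : ℕ => μ {ω | (∀ u, X n ω *ᵥ u = 0 → u = 0) ∧
      b * n ≤ ε n ω ⬝ᵥ (proj (X n ω) Finset.univ *ᵥ ε n ω)}) atTop (𝓝 0) := by
  have hv' : (0 : ℝ) < v := NNReal.coe_pos.2 hv
  refine tendsto_measure_of_le_ofReal (b := fun n : ℕ => Real.exp (-(b / (8 * v) * n)))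
    ?_ (tendsto_exp_neg_mul_nat (by positivity))
  filter_upwards [eventually_ge_atTop 1,
    eventually_dim_le_mul hp (l := b / (4 * v)) (by positivity)] with n hn hpn
  refine (measure_mono fun ω hω => ?_).trans ((measure_form_proj_sub_ge_le hv (hX n hn) (hε n hn)
    (hind n hn) (Finset.empty_subset (Finset.univ : Finset (Fin (p n))))
    (t := 1 / 4) (by norm_num) (by norm_num) (b * n)).trans (ENNReal.ofReal_le_ofReal ?_))
  · refine ⟨hω.1, ?_⟩
    rw [proj_empty, sub_zero]
    exact hω.2
  · rw [show (1 - 2 * (1 / 4) : ℝ) = 2⁻¹ by norm_num, Real.rpow_def_of_pos (by norm_num),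
      Real.log_inv, ← Real.exp_add, Real.exp_le_exp, Finset.sdiff_empty, Finset.card_univ,
      Fintype.card_fin]
    have hlog := Real.log_two_lt_d9
    have hpn0 : (0 : ℝ) ≤ p n := Nat.cast_nonneg _
    have h1 : 1 / 4 / v * (b * n) = b / (4 * v) * n := by field_simp
    have h2 : b / (8 * v) * n = b / (4 * v) * n / 2 := by field_simp; ring
    rw [h1, h2]
    nlinarith

theorem tendsto_measure_exists_proj_sub_gt (hv : 0 < v)
    (hX : ∀ n, 1 ≤ n → ∀ i j, Measurable fun ω => X n ω i j)
    (hε : ∀ n, 1 ≤ n → HasLaw (ε n) (Measure.pi fun _ : Fin n => gaussianReal 0 v) μ)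
    (hind : ∀ n, 1 ≤ n → IndepFun (fun ω i j => X n ω i j) (ε n) μ)
    (hp : (fun n : ℕ => (p n : ℝ) * Real.log n) =o[atTop] fun n : ℕ => (n : ℝ))
    (γ₀ : ∀ n, Finset (Fin (p n))) {a : ℝ} (ha : 0 < a) :
    Tendsto (fun n : ℕ => μ {ω | (∀ u, X n ω *ᵥ u = 0 → u = 0) ∧ ∃ γ ∈ S₁ (γ₀ n),
      (γ \ γ₀ n).card * (2 * v * (1 + a) * Real.log n) <
        ε n ω ⬝ᵥ ((proj (X n ω) γ - proj (X n ω) (γ₀ n)) *ᵥ ε n ω)}) atTop (𝓝 0) := by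
  have hv' : (0 : ℝ) < v := NNReal.coe_pos.2 hv
  -- Chosen so that `(1-s)(1+a) = 1 + a/2`. With Chernoff parameter `(1-s)/2`, a model adding `k`
  -- columns then fails with probability at most `x^k`, and the union bound is a binomial sum.
  set s := (a / 2) / (1 + a) with hs
  have hs0 : 0 < s := by positivity
  set x : ℕ → ℝ := fun n => s ^ (-(1 / 2) : ℝ) * (n : ℝ) ^ (-(1 + a / 2)) with hx
  have hx0 : ∀ n, 0 ≤ x n := fun n => by positivity
  refine tendsto_measure_of_le_ofReal (b := fun n : ℕ => (1 + x n) ^ p n - 1) ?_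
    (tendsto_one_add_pow_sub_one (Eventually.of_forall hx0) (by
      filter_upwards [eventually_dim_le_mul hp one_pos] with n h
      rw [one_mul] at h
      exact_mod_cast h) (half_pos ha) (Eventually.of_forall fun n => le_rfl))
  filter_upwards [eventually_ge_atTop 1] with n hn
  have hn0 : (0 : ℝ) < n := by exact_mod_cast hn
  set r := 2 * v * (1 + a) * Real.log n with hr
  set idx := (Finset.univ.erase (γ₀ n)).filter (γ₀ n ⊆ ·) with hidx
  calc μ {ω | (∀ u, X n ω *ᵥ u = 0 → u = 0) ∧ ∃ γ ∈ S₁ (γ₀ n),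
      (γ \ γ₀ n).card * r <
        ε n ω ⬝ᵥ ((proj (X n ω) γ - proj (X n ω) (γ₀ n)) *ᵥ ε n ω)}
      ≤ μ (⋃ γ ∈ idx, {ω | (∀ u, X n ω *ᵥ u = 0 → u = 0) ∧ (γ \ γ₀ n).card * r ≤
        ε n ω ⬝ᵥ ((proj (X n ω) γ - proj (X n ω) (γ₀ n)) *ᵥ ε n ω)}) := by
        refine measure_mono ?_
        rintro ω ⟨h1, γ, hγ, h2⟩
        simp only [Set.mem_iUnion]
        exact ⟨γ, by simp [hidx, hγ.1, hγ.2], h1, h2.le⟩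
    _ ≤ ∑ γ ∈ idx, μ {ω | (∀ u, X n ω *ᵥ u = 0 → u = 0) ∧ (γ \ γ₀ n).card * r ≤
        ε n ω ⬝ᵥ ((proj (X n ω) γ - proj (X n ω) (γ₀ n)) *ᵥ ε n ω)} :=
        measure_biUnion_finset_le _ _
    _ ≤ ∑ γ ∈ idx, ENNReal.ofReal (x n ^ (γ \ γ₀ n).card) := by
        refine Finset.sum_le_sum fun γ hγ => ?_
        refine (measure_form_proj_sub_ge_le hv (hX n hn) (hε n hn) (hind n hn)
          (Finset.mem_filter.1 hγ).2 (t := (1 - s) / 2) ?_ ?_ _).trans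
          (ENNReal.ofReal_le_ofReal (le_of_eq ?_))
        · have : s ≤ 1 := by rw [hs, div_le_one (by positivity)]; linarith
          linarith
        · linarith
        · set k := (γ \ γ₀ n).card
          rw [hx, mul_pow, ← Real.rpow_natCast, ← Real.rpow_natCast, ← Real.rpow_mul hs0.le,
            ← Real.rpow_mul hn0.le, Real.rpow_def_of_pos hn0, mul_comm]
          have h1 : (1 - s) * (1 + a) = 1 + a / 2 := by rw [hs]; field_simp; ring
          congr 2
          · ring
          · ring
          · have h2 : (1 - s) / 2 / v * (k * r) =
                v / v * (k * Real.log n * ((1 - s) * (1 + a))) := by rw [hr]; ring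
            rw [h2, div_self hv'.ne', h1]
            ring
    _ = ENNReal.ofReal (∑ γ ∈ idx, x n ^ (γ \ γ₀ n).card) :=
        (ENNReal.ofReal_sum_of_nonneg fun γ _ => pow_nonneg (hx0 n) _).symm
    _ ≤ _ := ENNReal.ofReal_le_ofReal (sum_pow_card_sdiff_le (hx0 n) (γ₀ n))

end Events

/-! ### Assembly. -/

section Main

theorem RegularDesign.mul_le {n p : ℕ} (hn : 1 ≤ n) {γ₀ : Finset (Fin p)} {c C : ℝ}
    {X : Matrix (Fin n) (Fin p) ℝ} (h : RegularDesign γ₀ c C X) {γ : Finset (Fin p)}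
    (hγ : ¬ γ₀ ⊆ γ) (v : (γ₀ \ γ : Finset (Fin p)) → ℝ) :
    n * c * (v ⬝ᵥ v) ≤
      v ⬝ᵥ (((cols X (γ₀ \ γ))ᵀ * (1 - proj X γ) * cols X (γ₀ \ γ)) *ᵥ v) := by
  have hn0 : (0 : ℝ) < n := by exact_mod_cast hn
  have h1 := h.1 γ hγ v
  rw [form_residGram, one_div, inv_mul_eq_div, le_div_iff₀ hn0] at h1
  linarith

theorem RegularDesign.mul_le_gram {n p : ℕ} (hn : 1 ≤ n) {γ₀ : Finset (Fin p)}
    (h₀ : γ₀.Nonempty) {c C : ℝ} {X : Matrix (Fin n) (Fin p) ℝ} (h : RegularDesign γ₀ c C X)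
    (v : γ₀ → ℝ) : n * c * (v ⬝ᵥ v) ≤ v ⬝ᵥ (((cols X γ₀)ᵀ * cols X γ₀) *ᵥ v) := by
  have h1 := fun v => h.mul_le hn
    (γ := ∅) (fun h => h₀.ne_empty (Finset.subset_empty.1 h)) v
  rw [Finset.sdiff_empty, proj_empty, sub_zero, Matrix.mul_one] at h1
  exact h1 v

theorem RegularDesign.gram_le_mul {n p : ℕ} (hn : 1 ≤ n) {γ₀ : Finset (Fin p)} {c C : ℝ}
    {X : Matrix (Fin n) (Fin p) ℝ} (h : RegularDesign γ₀ c C X) (v : γ₀ → ℝ) :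
    v ⬝ᵥ (((cols X γ₀)ᵀ * cols X γ₀) *ᵥ v) ≤ n * C * (v ⬝ᵥ v) := by
  have hn0 : (0 : ℝ) < n := by exact_mod_cast hn
  have h1 := h.2 v
  rw [form_residGram, proj_empty, sub_zero, Matrix.mul_one, one_div, inv_mul_eq_div,
    div_le_iff₀ hn0] at h1
  linarith

theorem mul_le_form_of_le_eigMin {n p : ℕ} (hn : 1 ≤ n) {γ η : Finset (Fin p)} {c : ℝ}
    {X : Matrix (Fin n) (Fin p) ℝ} (h : c ≤ eigMin (residGram X η γ)) (v : η → ℝ) :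
    n * c * (v ⬝ᵥ v) ≤ v ⬝ᵥ (((cols X η)ᵀ * (1 - proj X γ) * cols X η) *ᵥ v) := by
  have hn0 : (0 : ℝ) < n := by exact_mod_cast hn
  have h1 := form_ge_of_le_eigMin (residGram_transpose X η γ) h v
  rw [form_residGram, one_div, inv_mul_eq_div, le_div_iff₀ hn0] at h1
  linarith

theorem RegularDesign.mulVec_injective {n p : ℕ} (hn : 1 ≤ n) {γ₀ : Finset (Fin p)}
    (h₀ : γ₀.Nonempty) {c C d : ℝ} (hc : 0 < c) (hd : 0 < d) {X : Matrix (Fin n) (Fin p) ℝ}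
    (h : RegularDesign γ₀ c C X) (hS₁ : ∀ γ ∈ S₁ γ₀, d ≤ eigMin (residGram X (γ \ γ₀) γ₀)) :
    ∀ v, X *ᵥ v = 0 → v = 0 := by
  have hn0 : (0 : ℝ) < n := by exact_mod_cast hn
  refine mulVec_injective_of_forms (mul_pos hn0 hc) (mul_pos hn0 hd) (h.mul_le_gram hn h₀)
    fun v => ?_
  -- The full model belongs to `S₁` only if it differs from `γ₀`; otherwise there are no
  -- complementary columns.
  by_cases huniv : Finset.univ = γ₀
  · have : v = 0 := by
      funext ⟨j, hj⟩
      simp [← huniv] at hj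
    simp [this]
  · exact mul_le_form_of_le_eigMin hn (hS₁ _ ⟨Finset.subset_univ _, huniv⟩) v

theorem dist_iInf_one_le {ι : Type*} [Nonempty ι] {f : ι → ℝ} {T : ℝ} (h : ∀ i, 1 - T ≤ f i)
    (h1 : ∀ i, f i ≤ 1) : dist (⨅ i, f i) 1 ≤ T := by
  have hlow : 1 - T ≤ ⨅ i, f i := le_ciInf h
  have hup : ⨅ i, f i ≤ 1 :=
    (ciInf_le ⟨1 - T, by rintro _ ⟨i, rfl⟩; exact h i⟩ (Classical.arbitrary ι)).trans (h1 _)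
  rw [Real.dist_eq, abs_le]
  constructor <;> linarith

end Main

end BayesSel

-- The lower and upper limits are taken in `EReal` because the real-valued ones take default values
-- on unbounded sequences.
set_option maxHeartbeats 1000000 in
theorem mainTheorem7
    {Ω : Type*} [MeasurableSpace Ω] (μ : Measure Ω) [IsProbabilityMeasure μ]
    -- dimensions, noise level, degrees of freedom
    (p : ℕ → ℕ) (σ₀ : ℝ≥0) (hσ₀ : 0 < σ₀) (ν : ℝ) (hν : 0 < ν)
    -- true coefficients, random or deterministic designs, Gaussian errors
    (β₀ : ∀ n, Fin (p n) → ℝ)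
    (X : ∀ n, Ω → Matrix (Fin n) (Fin (p n)) ℝ)
    (ε : ∀ n, Ω → Fin n → ℝ)
    (hX : ∀ n, 1 ≤ n → ∀ i j, Measurable fun ω => X n ω i j)
    (hε : ∀ n, 1 ≤ n → HasLaw (ε n) (Measure.pi fun _ : Fin n => gaussianReal 0 (σ₀ ^ 2)) μ)
    (hindep : ∀ n, 1 ≤ n → IndepFun (fun ω i j => X n ω i j) (ε n) μ)
    -- the true model is nonnull
    (hnonnull : ∀ n, 1 ≤ n → (BayesSel.stateOf (β₀ n)).Nonempty)
    -- prior on the models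
    (prior : ∀ n, PMF (Finset (Fin (p n)))) (C₀ : ℝ) (hC₀ : 0 < C₀)
    (hpriorpos : ∀ n, 1 ≤ n → prior n (BayesSel.stateOf (β₀ n)) ≠ 0)
    (hprior : ∀ n, 1 ≤ n → ∀ γ : Finset (Fin (p n)),
      (prior n γ).toReal / (prior n (BayesSel.stateOf (β₀ n))).toReal ≤ C₀)
    -- eigenvalue conditions on the design
    (C₁ C₂ : ℝ) (hC₁ : 0 < C₁) (hC₂ : 0 < C₂)
    (hmin : ∀ᵐ ω ∂μ, (C₁ : EReal) ≤
      liminf (fun n => ((BayesSel.phiMin (BayesSel.stateOf (β₀ n)) (X n ω) : ℝ) : EReal)) atTop)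
    (hmax : ∀ᵐ ω ∂μ,
      limsup (fun n => ((BayesSel.phiMax (BayesSel.stateOf (β₀ n)) (X n ω) : ℝ) : EReal)) atTop
        ≤ (C₂ : EReal))
    (C₃ δ : ℝ) (hC₃ : 0 < C₃) (hδ : 0 ≤ δ)
    (hS₁ : ∀ n, 1 ≤ n → ∀ᵐ ω ∂μ, ∀ γ ∈ BayesSel.S₁ (BayesSel.stateOf (β₀ n)),
      C₃ * (n : ℝ) ^ (-δ) ≤ BayesSel.eigMin
        (BayesSel.residGram (X n ω) (γ \ BayesSel.stateOf (β₀ n)) (BayesSel.stateOf (β₀ n))))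
    -- size of the nonzero coefficients
    (ψ : ℕ → ℝ) (hψ : ∃ m > 0, ∀ n, 1 ≤ n → m ≤ ψ n)
    (hβ₀ : ∀ n, 1 ≤ n → ∀ j ∈ BayesSel.stateOf (β₀ n), ψ n ≤ |β₀ n j|)
    -- growth conditions
    (hp : (fun n : ℕ => (p n : ℝ) * Real.log n) =o[atTop] fun n : ℕ => (n : ℝ))
    (δ₀ : ℝ) (hδ₀ : 3 + δ < δ₀)
    (hk : (fun n : ℕ => ∑ j ∈ BayesSel.stateOf (β₀ n), β₀ n j ^ 2)
      =O[atTop] fun n : ℕ => (n : ℝ) ^ δ₀)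
    (φlo φhi : ℕ → ℝ) (hφlo : ∀ n, 1 ≤ n → 0 < φlo n) (hφ : ∀ n, 1 ≤ n → φlo n ≤ φhi n)
    (hφhiO : φhi =O[atTop] fun n : ℕ => (n : ℝ) ^ δ₀)
    (hφloO : (fun n : ℕ => (n : ℝ) ^ δ₀) =O[atTop] φlo) :
    TendstoInMeasure μ
      (fun n ω => ⨅ c : {c : Fin (p n) → ℝ // ∀ j, c j ∈ Set.Icc (φlo n) (φhi n)},
        BayesSel.posterior ν (prior n) (c : Fin (p n) → ℝ) (X n ω)
          (X n ω *ᵥ β₀ n + ε n ω) (BayesSel.stateOf (β₀ n)))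
      atTop (fun _ => 1) := by
  open BayesSel in
  obtain ⟨m, hm, hmψ⟩ := hψ
  set v : ℝ≥0 := σ₀ ^ 2 with hvdef
  have hv : 0 < v := pow_pos hσ₀ 2
  have hv' : (0 : ℝ) < v := NNReal.coe_pos.2 hv
  set κ := δ₀ - 3 - δ with hκ
  have hκ0 : 0 < κ := by linarith
  set a := min (1 / 4) (κ / 20) with ha
  have ha0 : 0 < a := lt_min (by norm_num) (by positivity)
  have ha4 : a ≤ 1 / 4 := min_le_left _ _
  have haκ : a ≤ κ / 20 := min_le_right _ _
  -- The first entry keeps the full-model residual above `(1-a) v n`. The second makes three times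
  -- the projected noise at most `C₁ m² n / 16`; with `K` below the same amount, the signal term `C₁
  -- m² n / 4` leaves the gap `C₁ m² n / 8`.
  set b := min (a / 2 * v) (C₁ * m ^ 2 / 48) with hb
  have hb0 : 0 < b := lt_min (by positivity) (by positivity)
  have hbv : b ≤ a / 2 * v := min_le_left _ _
  have hbC : b ≤ C₁ * m ^ 2 / 48 := min_le_right _ _
  obtain ⟨Mk, hMk, hkO⟩ := hk.exists_pos
  obtain ⟨Ml, hMl, hlO⟩ := hφloO.exists_pos
  -- Bounds the ridge penalty: `k_n / φlo ≤ Mk Ml`, `1 / φlo ≤ Ml`, and the noise part of the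
  -- coefficient has squared length at most `4v/C₁`.
  set K := Ml * (2 * Mk + 8 * v / C₁) with hK
  have hK0 : 0 < K := by positivity
  set γ₀ : ∀ n, Finset (Fin (p n)) := fun n => stateOf (β₀ n) with hγ₀
  -- the exceptional events
  set A : ℕ → Set Ω := fun n => {ω | 1 ≤ n → RegularDesign (γ₀ n) (C₁ / 2) (2 * C₂) (X n ω)}
    with hA
  have hAm : ∀ n, MeasurableSet (A n) := by
    intro n
    by_cases hn : 1 ≤ n
    · have h1 : Measurable fun ω i j => X n ω i j :=
        measurable_pi_lambda _ fun i => measurable_pi_lambda _ fun j => hX n hn i j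
      have h2 := h1 (measurableSet_regularDesign (γ₀ n) (C₁ / 2) (2 * C₂))
      have h3 : A n = {ω | RegularDesign (γ₀ n) (C₁ / 2) (2 * C₂) (X n ω)} := by
        ext ω; simp [hA, hn]
      rw [h3]
      exact h2
    · have h3 : A n = Set.univ := by ext ω; simp [hA, hn]
      rw [h3]
      exact MeasurableSet.univ
  have hAev : ∀ᵐ ω ∂μ, ∀ᶠ n in atTop, ω ∈ A n := by
    filter_upwards [hmin, hmax] with ω h1 h2
    have h3 := eventually_lt_of_lt_liminf
      (lt_of_lt_of_le (EReal.coe_lt_coe_iff.2 (half_lt_self hC₁)) h1)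
    have h4 := eventually_lt_of_limsup_lt
      (lt_of_le_of_lt h2 (EReal.coe_lt_coe_iff.2 (by linarith : C₂ < 2 * C₂)))
    filter_upwards [h3, h4] with n h5 h6 hn
    exact regularDesign_of_phi (hnonnull n hn) (EReal.coe_lt_coe_iff.1 h5).le
      (EReal.coe_lt_coe_iff.1 h6).le
  have hlimA := tendsto_measure_compl_of_ae_eventually hAm hAev
  have hlim1 := tendsto_measure_sum_sq_gt hv hε
  have hlim2 := tendsto_measure_sum_sq_lt hv hε (half_pos ha0)
  have hlim3 := tendsto_measure_proj_ge hv hX hε hindep hp hb0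
  have hlim4 := tendsto_measure_exists_proj_sub_gt hv hX hε hindep hp γ₀ ha0
  have hlim := (((hlimA.add hlim1).add hlim2).add hlim3).add hlim4
  simp only [add_zero] at hlim
  -- the deterministic bound
  have hT1 := tendsto_overfit_bound hp (K := K) (C := C₀) hν hv' ha0 ha4 haκ hC₃
    (by rw [hκ]; ring : δ₀ = 3 + δ + κ) hφloO hφlo
  have hT2 := tendsto_underfit_bound hp (C := C₀) (C₂ := 2 * C₂) (Λ := 3 * v)
    (d := C₁ * m ^ 2 / 8) hν hC₀ (by positivity) (by positivity) (by positivity)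
    (by linarith : 0 ≤ δ₀) hφhiO fun n hn => (hφlo n hn).trans_le (hφ n hn)
  have hT := hT1.add hT2
  rw [add_zero] at hT
  rw [tendstoInMeasure_iff_dist]
  intro r hr
  refine tendsto_of_tendsto_of_tendsto_of_le_of_le' tendsto_const_nhds hlim
    (Eventually.of_forall fun _ => zero_le) ?_
  filter_upwards [hT.eventually_lt_const hr, hkO.bound, hlO.bound, eventually_ge_atTop 1,
    eventually_ge_atTop ⌈(1 + K) / v⌉₊, eventually_ge_atTop ⌈K / (C₁ * m ^ 2 / 16)⌉₊] with
    n hTn hkn hln hn hnK1 hnK2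
  have hn1 : (1 : ℝ) ≤ n := by exact_mod_cast hn
  have hn0 : (0 : ℝ) < n := by linarith
  have hlo := hφlo n hn
  have hlohi := hφ n hn
  have hnδ : 1 ≤ (n : ℝ) ^ δ₀ := Real.one_le_rpow hn1 (by linarith)
  have hK1 : 1 + K ≤ v * n := by
    have := Nat.ceil_le.1 hnK1
    rwa [div_le_iff₀ hv', mul_comm] at this
  have hK2 : K ≤ C₁ * m ^ 2 / 16 * n := by
    have := Nat.ceil_le.1 hnK2
    rwa [div_le_iff₀ (by positivity), mul_comm] at this
  have hkn' : ∑ j ∈ γ₀ n, β₀ n j ^ 2 ≤ Mk * (n : ℝ) ^ δ₀ := by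
    rw [Real.norm_of_nonneg (by positivity : 0 ≤ (n : ℝ) ^ δ₀)] at hkn
    exact (Real.le_norm_self _).trans hkn
  have hln' : (n : ℝ) ^ δ₀ ≤ Ml * φlo n := by
    rwa [Real.norm_of_nonneg (by positivity : 0 ≤ (n : ℝ) ^ δ₀), Real.norm_of_nonneg hlo.le]
      at hln
  have hpriorle : ∀ γ, (prior n γ).toReal ≤ C₀ * (prior n (γ₀ n)).toReal := fun γ => by
    have h1 : 0 < (prior n (γ₀ n)).toReal :=
      ENNReal.toReal_pos (hpriorpos n hn) ((prior n).apply_ne_top _)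
    exact (div_le_iff₀ h1).1 (hprior n hn γ)
  -- The inclusion in the five exceptional events holds only almost everywhere, since the condition
  -- on `S₁` is almost sure.
  refine le_trans (measure_mono_ae ?_) ((measure_union_le _ _).trans (add_le_add
    ((measure_union_le _ _).trans (add_le_add ((measure_union_le _ _).trans
    (add_le_add (measure_union_le _ _) le_rfl)) le_rfl)) le_rfl))
  filter_upwards [hS₁ n hn] with ω hωS₁ hωr
  by_contra hcon
  obtain ⟨⟨⟨⟨hA', h1'⟩, h2'⟩, h3'⟩, h4'⟩ : (((ω ∈ A n ∧ ¬ 2 * v * n < ε n ω ⬝ᵥ ε n ω) ∧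
      ¬ ε n ω ⬝ᵥ ε n ω < (1 - a / 2) * v * n) ∧
      ¬ ((∀ u, X n ω *ᵥ u = 0 → u = 0) ∧
        b * n ≤ ε n ω ⬝ᵥ (proj (X n ω) Finset.univ *ᵥ ε n ω))) ∧
      ¬ ((∀ u, X n ω *ᵥ u = 0 → u = 0) ∧ ∃ γ ∈ S₁ (γ₀ n),
        (γ \ γ₀ n).card * (2 * v * (1 + a) * Real.log n) <
          ε n ω ⬝ᵥ ((proj (X n ω) γ - proj (X n ω) (γ₀ n)) *ᵥ ε n ω)) := by
    refine ⟨⟨⟨⟨?_, ?_⟩, ?_⟩, ?_⟩, ?_⟩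
    · by_contra h
      exact hcon (Or.inl (Or.inl (Or.inl (Or.inl h))))
    · exact fun h => hcon (Or.inl (Or.inl (Or.inl (Or.inr h))))
    · exact fun h => hcon (Or.inl (Or.inl (Or.inr h)))
    · exact fun h => hcon (Or.inl (Or.inr h))
    · exact fun h => hcon (Or.inr h)
  have hreg : RegularDesign (γ₀ n) (C₁ / 2) (2 * C₂) (X n ω) := hA' hn
  have hd0 : 0 < C₃ * (n : ℝ) ^ (-δ) := by positivity
  have hinj := hreg.mulVec_injective hn (hnonnull n hn) (half_pos hC₁) hd0 hωS₁
  set e := ε n ω with he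
  set Q := e ⬝ᵥ (proj (X n ω) Finset.univ *ᵥ e) with hQ
  have hE1 : e ⬝ᵥ e ≤ 2 * v * n := not_lt.1 h1'
  have hE2 : (1 - a / 2) * v * n ≤ e ⬝ᵥ e := not_lt.1 h2'
  have hQb : Q ≤ b * n := by
    by_contra h
    exact h3' ⟨hinj, (not_le.1 h).le⟩
  have hq : ∀ γ ∈ S₁ (γ₀ n), e ⬝ᵥ ((proj (X n ω) γ - proj (X n ω) (γ₀ n)) *ᵥ e) ≤
      (γ \ γ₀ n).card * (2 * v * (1 + a) * Real.log n) := fun γ hγ => by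
    by_contra h
    exact h4' ⟨hinj, γ, hγ, not_le.1 h⟩
  have hKbound : (2 * ∑ j ∈ γ₀ n, β₀ n j ^ 2 + 2 * (e ⬝ᵥ e / (n * (C₁ / 2)))) / φlo n ≤ K := by
    rw [div_le_iff₀ hlo]
    have h5 : e ⬝ᵥ e / (n * (C₁ / 2)) ≤ 4 * v / C₁ := by
      rw [div_le_div_iff₀ (by positivity) hC₁]
      linarith [mul_le_mul_of_nonneg_right hE1 hC₁.le]
    have h6 : 8 * v / C₁ * 1 ≤ 8 * v / C₁ * (Ml * φlo n) :=
      mul_le_mul_of_nonneg_left (hnδ.trans hln') (by positivity)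
    have h7 : Mk * (n : ℝ) ^ δ₀ ≤ Mk * (Ml * φlo n) := mul_le_mul_of_nonneg_left hln' hMk.le
    have h8 : 8 * v / C₁ = 2 * (4 * v / C₁) := by ring
    have h9 : K * φlo n = 2 * (Mk * (Ml * φlo n)) + 8 * v / C₁ * (Ml * φlo n) := by
      rw [hK]; ring
    rw [h9]
    linarith
  have hlow : (1 - a) * v * n ≤ e ⬝ᵥ e - Q := by
    have := mul_le_mul_of_nonneg_right hbv hn0.le
    linarith
  have hgap : C₁ * m ^ 2 / 8 * n ≤ n * (C₁ / 2) * m ^ 2 / 2 - 3 * Q - K := by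
    have := mul_le_mul_of_nonneg_right hbC hn0.le
    linarith
  have hne : Nonempty {c : Fin (p n) → ℝ // ∀ j, c j ∈ Set.Icc (φlo n) (φhi n)} :=
    ⟨⟨fun _ => φlo n, fun _ => ⟨le_rfl, hlohi⟩⟩⟩
  have hdist := dist_iInf_one_le
    (f := fun c : {c : Fin (p n) → ℝ // ∀ j, c j ∈ Set.Icc (φlo n) (φhi n)} =>
      posterior ν (prior n) (c : Fin (p n) → ℝ) (X n ω) (X n ω *ᵥ β₀ n + e) (stateOf (β₀ n)))
    (fun c => one_sub_le_posterior hν hlo (fun j => (c.2 j).1) (fun j => (c.2 j).2) hlohi hinj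
      hC₀ (hpriorpos n hn) hpriorle (g := n * (C₁ / 2)) (G := n * (2 * C₂))
      (h := n * (C₃ * (n : ℝ) ^ (-δ))) (by positivity) (by positivity) (by positivity)
      (hreg.mul_le_gram hn (hnonnull n hn)) (hreg.gram_le_mul hn)
      (fun γ hγ => mul_le_form_of_le_eigMin hn (hωS₁ γ hγ))
      (fun γ hγ => hreg.mul_le hn hγ) hm.le
      (fun j hj => (hmψ n hn).trans (hβ₀ n hn j hj)) (K := K) (L := (1 - a) * v * n)
      (B := 2 * v * (1 + a) * Real.log n) (Λ := 3 * v * n) (d := C₁ * m ^ 2 / 8 * n)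
      hK0.le (mul_pos (mul_pos (by linarith) hv') hn0)
      (mul_nonneg (by positivity) (Real.log_nonneg hn1)) (by positivity) hKbound hlow hq
      (by linarith) hgap)
    (fun c => posterior_le_one ν (prior n) (fun j => hlo.trans_le (c.2 j).1) _ _ _)
  exact absurd (lt_of_le_of_lt hdist hTn) (not_lt.2 hωr)
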